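/- **Setting.** Let $X\in\mathbb R^{n\times p}$ with columns $X_1,\dots,X_p$, $\beta^0\in\mathbb R^p$, $\sigma>0$ and $Y\sim\mathcal N_n(X\beta^0,\sigma^2\mathrm{Id}_n)$. Let $1\le K<\min(n-3,\operatorname{rank}X)$ and $0\le a\le K-1$. A signed variable $i\in[2p]$ encodes a variable $j\in[p]$ and a sign $s=\pm1$ by $i=j+p(1-s)/2$. Put $$Z=(X^\top Y,-X^\top Y)\in\mathbb R^{2p},\qquad R=\begin{pmatrix}X^\top X&-X^\top X\\-X^\top X&X^\top X\end{pmatrix}.$$ For signed variables $i_1,\dots,i_k$ let $M_{i_1,\dots,i_k}=(R_{i_b,i_c})_{1\le b,c\le k}$, $r_j=(R_{j,i_1},\dots,R_{j,i_k})$, and $\theta_j(i_1,\dots,i_k)=r_j M_{i_1,\dots,i_k}^{-1}(1,\dots,1)^\top$ (which is $0$ for $k=0$). For $k\ge1$ let $$\rho_k=\frac{\sqrt{R_{i_k,i_k}-r\,M_{i_1,\dots,i_{k-1}}^{-1}\,r^\top}}{1-\theta_{i_k}(i_1,\dots,i_{k-1})},\qquad r=(R_{i_k,i_1},\dots,R_{i_k,i_{k-1}}).$$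 **LAR.** The knots $\lambda_k$ and signed variables $\hat\imath_k$ are produced by the LAR algorithm. Start with $N^{(1)}=Z$, $\lambda_1=\max Z$, $\hat\imath_1=\arg\max Z$. Given step $k$, set $N^{(k+1)}(\beta)=N^{(k)}-(\lambda_k-\beta)\,\theta(\hat\imath_1,\dots,\hat\imath_k)$. Let $\lambda_{k+1}$ be the largest $\beta\in(0,\lambda_k]$ such that $N^{(k+1)}_j(\beta)=\beta$ for some signed $j$ whose variable has not yet entered, let $\hat\imath_{k+1}$ be the argmax of $N^{(k+1)}(\lambda_{k+1})$ over such $j$, and put $N^{(k+1)}=N^{(k+1)}(\lambda_{k+1})$. Ties are broken by a fixed deterministic rule that depends only on the set of maximisers. **Stopping rule.** Let $n=n_1+n_2+K+1$ with $n_1,n_2\ge1$. With $\hat P^\perp$ the orthogonal projection onto the orthogonal complement of the span of the columns of the variables of $\hat\imath_1,\dots,\hat\imath_{K+1}$, let $E_1$ be the subspace $\hat P^\perp(\mathrm{Span}(e_1,\dots,e_\ell))$ of dimension $n_1$ (for a suitable $\ell$), and $\hat\sigma_{\rm select}=\|P_{E_1}Y\|_2/\sqrt{n_1}$. Let $\hat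 m\in\{0,\dots,K-1\}$ be such that for every $0\le a'\le K-1$ the indicator of $\{\hat m\le a'\}$ is a measurable function of $(\lambda_1,\dots,\lambda_{a'},\hat\imath_1,\dots,\hat\imath_{K+1},\hat\sigma_{\rm select})$. **Transformed knots.** Let $\Phi_k$ be the CDF of $\mathcal N(0,\sigma^2\rho_k^2)$, with $\rho_k$ computed along the selected signed variables, $F_k=\Phi_k(\lambda_k)$ for $k\ge1$, $F_0=1$, and $\mathcal P_{i,j}=\Phi_i\circ\Phi_j^{-1}$ on $(0,1)$, with the convention $\mathcal P_{1,0}(F_0)=1$. **Claim.** Let $(i_1,\dots,i_{K+1})$ be signed variables such that: - (Irrepresentable Check) the variables of $i_1,\dots,i_K$ are pairwise different and, for all $1\le k\le K$ and all signed variables $j$ whose variable is not one of those of $i_1,\dots,i_k$, $\theta_j(i_1,\dots,i_k)<1$; - (null hypothesis $\mathbb H_0$) $X\beta^0\in H_a$, the span of the columns of the variables of $i_1,\dots,i_a$; - $\mathbb P(\hat m=a,\ \hat\imath_1=i_1,\dots,\hat\imath_{K+1}=i_{K+1})>0$. Then, conditional on $\{\hat m=a,\ \hat\imath_1=i_1,\dots,\hat\imath_{K+1}=i_{K+1}\}$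 and on $(F_a,F_{K+1})$, the vector $(F_{a+1},\dots,F_K)$ is almost surely uniformly distributed (with respect to Lebesgue measure) on $$\mathcal D_{a+1,K}=\big\{(f_{a+1},\dots,f_K)\in(0,1)^{K-a}:\ \mathcal P_{a+1,a}(F_a)\ge f_{a+1}\ge\mathcal P_{a+1,a+2}(f_{a+2})\ge\cdots\ge\mathcal P_{a+1,K}(f_K)\ge\mathcal P_{a+1,K+1}(F_{K+1})\big\}.$$ -/

import Mathlib

open MeasureTheory ProbabilityTheory

namespace LAR

noncomputable section

/-- Signed variables `[2p]`: `Sum.inl j` is the variable `j` with sign `+1`, and `Sum.inr j`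
(that is, `j + p`) is the variable `j` with sign `-1`. -/
abbrev SVar (p : ℕ) : Type := Fin p ⊕ Fin p

/-- The unsigned variable underlying a signed variable. -/
def SVar.var {p : ℕ} (i : SVar p) : Fin p := Sum.elim id id i

variable {n p : ℕ}

/-- The `2p × 2p` matrix `R = [[XᵀX, -XᵀX], [-XᵀX, XᵀX]]`. -/
def R (X : Matrix (Fin n) (Fin p) ℝ) : Matrix (SVar p) (SVar p) ℝ :=
  Matrix.fromBlocks (X.transpose * X) (-(X.transpose * X)) (-(X.transpose * X)) (X.transpose * X)

/-- The `2p`-vector `Z = (Xᵀy, -Xᵀy)`. -/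
def Z (X : Matrix (Fin n) (Fin p) ℝ) (y : EuclideanSpace ℝ (Fin n)) : SVar p → ℝ :=
  Sum.elim (X.transpose.mulVec (WithLp.ofLp y)) (-(X.transpose.mulVec (WithLp.ofLp y)))

/-! Sequences of signed variables are functions `i : ℕ → SVar p`, of which only the entries
`i 1, …, i k` matter for an object of order `k`. -/

/-- The matrix `M_{i₁,…,i_k}`, the submatrix of `R` with rows and columns `i₁, …, i_k`. -/
def M (X : Matrix (Fin n) (Fin p) ℝ) (i : ℕ → SVar p) (k : ℕ) : Matrix (Fin k) (Fin k) ℝ :=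
  Matrix.of fun b c => R X (i (b + 1)) (i (c + 1))

/-- The row `(R_{j,i₁}, …, R_{j,i_k})`. -/
def Rrow (X : Matrix (Fin n) (Fin p) ℝ) (i : ℕ → SVar p) (k : ℕ) (j : SVar p) : Fin k → ℝ :=
  fun b => R X j (i (b + 1))

/-- `θ_j(i₁,…,i_k) = (R_{j,i₁} ⋯ R_{j,i_k}) M⁻¹ (1,…,1)`. -/
def theta (X : Matrix (Fin n) (Fin p) ℝ) (i : ℕ → SVar p) (k : ℕ) (j : SVar p) : ℝ :=
  dotProduct (Rrow X i k j) ((M X i k)⁻¹.mulVec 1)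

/-- `ρ_k`, for `k ≥ 1`, along the sequence `i`; for `k = 1` it is `√(R_{i₁,i₁})`. -/
def rho (X : Matrix (Fin n) (Fin p) ℝ) (i : ℕ → SVar p) (k : ℕ) : ℝ :=
  Real.sqrt (R X (i k) (i k) -
      dotProduct (Rrow X i (k - 1) (i k))
        ((M X i (k - 1))⁻¹.mulVec (Rrow X i (k - 1) (i k)))) /
    (1 - theta X i (k - 1) (i k))

/-- `(i₁,…,i_K)` is an active set (the underlying variables are pairwise different) that satisfies
the Irrepresentable Check: for all `k ∈ [K]` and every signed variable `j` whose underlying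
variable is not among those of `i₁,…,i_k`, one has `θ_j(i₁,…,i_k) < 1`. -/
def IrrCheck (X : Matrix (Fin n) (Fin p) ℝ) (K : ℕ) (i : ℕ → SVar p) : Prop :=
  Set.InjOn (fun k => (i k).var) (Set.Icc 1 K) ∧
  ∀ k ∈ Set.Icc 1 K, ∀ j : SVar p, (∀ l ∈ Set.Icc 1 k, (i l).var ≠ j.var) → theta X i k j < 1

/-! ### The LAR algorithm -/

/-- The state of the LAR algorithm after `k` steps: the knot `λ_k`, the residual correlations
`N^{(k)} = (N̄^{(k)}, -N̄^{(k)})`, and the signed variables selected so far (entries `1, …, k`). -/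
structure State (p : ℕ) where
  knot : ℝ
  res : SVar p → ℝ
  idx : ℕ → SVar p

/-- The signed variables whose underlying variable has not entered in the first `k` steps. -/
def inactive (i : ℕ → SVar p) (k : ℕ) : Set (SVar p) :=
  {j | ∀ l ∈ Set.Icc 1 k, (i l).var ≠ j.var}

open Classical in
/-- The argmax of `f` over the set `s`; `tie` selects one of the maximisers when there are
several. -/
def argmaxOn (tie : Finset (SVar p) → SVar p) (s : Set (SVar p)) (f : SVar p → ℝ) : SVar p :=
  tie (Finset.univ.filter fun j => j ∈ s ∧ ∀ j' ∈ s, f j' ≤ f j)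

/-- `N^{(k+1)}(β) = N^{(k)} - (λ_k - β) θ(î₁,…,î_k)`. -/
def resAt (X : Matrix (Fin n) (Fin p) ℝ) (k : ℕ) (s : State p) (β : ℝ) : SVar p → ℝ :=
  fun j => s.res j - (s.knot - β) * theta X s.idx k j

/-- `λ_{k+1}`: the largest `β ∈ (0, λ_k]` at which an inactive coordinate of `N^{(k+1)}(β)`
reaches the level `β`. -/
def nextKnot (X : Matrix (Fin n) (Fin p) ℝ) (k : ℕ) (s : State p) : ℝ :=
  sSup {β : ℝ | 0 < β ∧ β ≤ s.knot ∧ ∃ j ∈ inactive s.idx k, resAt X k s β j = β}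

/-- The LAR algorithm, in signed variables, run on the response `y`. The first step takes
`N^{(1)} = Z`, `λ₁ = max Z` and `î₁ = argmax Z`. (The value at `0` is a placeholder.) -/
def path (X : Matrix (Fin n) (Fin p) ℝ) (tie : Finset (SVar p) → SVar p)
    (y : EuclideanSpace ℝ (Fin n)) : ℕ → State p
  | 0 => ⟨0, Z X y, fun _ => tie ∅⟩
  | 1 => ⟨⨆ j, Z X y j, Z X y, fun _ => argmaxOn tie Set.univ (Z X y)⟩
  | k + 2 =>
    let s := path X tie y (k + 1)
    let N := resAt X (k + 1) s (nextKnot X (k + 1) s)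
    ⟨nextKnot X (k + 1) s, N,
      Function.update s.idx (k + 2) (argmaxOn tie (inactive s.idx (k + 1)) N)⟩

/-- The knot `λ_k`, for `k ≥ 1`. -/
def knot (X : Matrix (Fin n) (Fin p) ℝ) (tie : Finset (SVar p) → SVar p)
    (y : EuclideanSpace ℝ (Fin n)) (k : ℕ) : ℝ :=
  (path X tie y k).knot

/-- The signed variable `î_k`, for `k ≥ 1`. -/
def ihat (X : Matrix (Fin n) (Fin p) ℝ) (tie : Finset (SVar p) → SVar p)
    (y : EuclideanSpace ℝ (Fin n)) (k : ℕ) : SVar p :=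
  (path X tie y k).idx k

/-! ### Nested models and the variance estimate used for selection -/

/-- The span `H_k` of the columns `X_{j₁}, …, X_{j_k}` of the design. -/
def modelSpace (X : Matrix (Fin n) (Fin p) ℝ) (i : ℕ → SVar p) (k : ℕ) :
    Submodule ℝ (EuclideanSpace ℝ (Fin n)) :=
  Submodule.span ℝ ((fun l => WithLp.toLp 2 (fun r => X r (i l).var)) '' Set.Icc 1 k)

/-- The image of `V_ℓ = Span(e₁, …, e_ℓ)` under the orthogonal projection onto the orthogonal
complement of `X_{j₁}, …, X_{j_m}`. -/
def projV (X : Matrix (Fin n) (Fin p) ℝ) (i : ℕ → SVar p) (m ℓ : ℕ) :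
    Submodule ℝ (EuclideanSpace ℝ (Fin n)) :=
  (Submodule.span ℝ ((fun r : Fin n => EuclideanSpace.single r (1 : ℝ)) '' {r | (r : ℕ) < ℓ})).map
    ((modelSpace X i m)ᗮ.starProjection : EuclideanSpace ℝ (Fin n) →ₗ[ℝ] EuclideanSpace ℝ (Fin n))

/-- The space `E₁`: the image above for an `ℓ` such that it has dimension `n₁`. The images
increase with `ℓ`, so `E₁` does not depend on which such `ℓ` is taken. -/
def E1 (X : Matrix (Fin n) (Fin p) ℝ) (i : ℕ → SVar p) (m n₁ : ℕ) :
    Submodule ℝ (EuclideanSpace ℝ (Fin n)) :=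
  projV X i m (sInf {ℓ | Module.finrank ℝ (projV X i m ℓ) = n₁})

/-- `σ̂_select = ‖P_{E₁} y‖ / √n₁`, where `E₁` is built from the variables `î₁, …, î_{K+1}`. -/
def sigmaSelect (X : Matrix (Fin n) (Fin p) ℝ) (tie : Finset (SVar p) → SVar p) (K n₁ : ℕ)
    (y : EuclideanSpace ℝ (Fin n)) : ℝ :=
  ‖(E1 X (ihat X tie y) (K + 1) n₁).starProjection y‖ / Real.sqrt n₁

/-- Stopping rule: `m̂ ≤ K - 1` and, for all `a ≤ K - 1`, the indicator of `{m̂ ≤ a}` is a measurable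
function of `(λ₁, …, λ_a, î₁, …, î_{K+1}, σ̂_select)`. The value `m̂ = 0` is allowed. -/
def IsStoppingRule {Ω : Type*} (X : Matrix (Fin n) (Fin p) ℝ) (tie : Finset (SVar p) → SVar p)
    (K n₁ : ℕ) (Y : Ω → EuclideanSpace ℝ (Fin n)) (mhat : Ω → ℕ) : Prop :=
  (∀ ω, mhat ω ≤ K - 1) ∧
  ∀ a ≤ K - 1, ∃ B : Set ((Fin a → ℝ) × (Fin (K + 1) → SVar p) × ℝ), MeasurableSet B ∧
    ∀ ω, mhat ω ≤ a ↔
      ((fun l : Fin a => knot X tie (Y ω) (l + 1)),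
        (fun l : Fin (K + 1) => ihat X tie (Y ω) (l + 1)),
        sigmaSelect X tie K n₁ (Y ω)) ∈ B

/-! ### CDF-transformed knots and the domain of the uniform law -/

/-- The CDF of the centred Gaussian law with standard deviation `s`. -/
def Phi (s x : ℝ) : ℝ := cdf (gaussianReal 0 (s ^ 2).toNNReal) x

/-- `𝒫_{i,j} = Φ_i ∘ Φ_j⁻¹`, where `Φ_k` has standard deviation `s k`. The inverse is meant on
`(0,1)`, the range of `Φ_j`. -/
def P (s : ℕ → ℝ) (i j : ℕ) (u : ℝ) : ℝ := Phi (s i) (Function.invFun (Phi (s j)) u)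

/-- `F_k = Φ_k(λ_k)`, where `Φ_k` has standard deviation `σρ_k`, and `F_0 = 1`. -/
def F (X : Matrix (Fin n) (Fin p) ℝ) (tie : Finset (SVar p) → SVar p) (σ : ℝ)
    (y : EuclideanSpace ℝ (Fin n)) (k : ℕ) : ℝ :=
  if k = 0 then 1 else Phi (σ * rho X (ihat X tie y) k) (knot X tie y k)

/-- The domain `𝒟_{a+1,K}` for `F_a = u` and `F_{K+1} = v`, the coordinate `c` of `f` being
`f_{a+1+c}`: the set of `f` (in the domain `(0,1)` of the inverse CDFs) with
`𝒫_{a+1,a}(u) ≥ f_{a+1} ≥ 𝒫_{a+1,a+2}(f_{a+2}) ≥ ⋯ ≥ 𝒫_{a+1,K}(f_K) ≥ 𝒫_{a+1,K+1}(v)`.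
The map `𝒫_{a+1,a+1}`, the identity of `(0,1)`, is written in front of `f_{a+1}`, and
for `a = 0` the upper bound is `1` (as `F_0 = 1` and `λ_0 = ∞`). -/
def domainD (s : ℕ → ℝ) (a K : ℕ) (u v : ℝ) : Set (Fin (K - a) → ℝ) :=
  {f | (∀ c, f c ∈ Set.Ioo (0 : ℝ) 1) ∧
    (∀ c : Fin (K - a), (c : ℕ) = 0 → f c ≤ if a = 0 then 1 else P s (a + 1) a u) ∧
    (∀ c d : Fin (K - a), (d : ℕ) = c + 1 →
      P s (a + 1) (a + 1 + d) (f d) ≤ P s (a + 1) (a + 1 + c) (f c)) ∧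
    (∀ c : Fin (K - a), (c : ℕ) + 1 = K - a → P s (a + 1) (K + 1) v ≤ P s (a + 1) (a + 1 + c) (f c))}

end

end LAR

/-! Write x_j for the signed column of j and P_k^⊥ for the projection onto the orthogonal complement
of H_k. The residual correlation of j at level b is ⟪x_j, P_k^⊥ y⟫ + b θ_j, so j reaches the level
at ⟪x_j, P_k^⊥ y⟫ / (1 - θ_j), called `beta`. The Irrepresentable Check makes 1 - θ_j positive,
hence λ_{k+1} is the maximum of `beta` over the inactive variables (`StepOutcome.succ`). Along a
fixed sequence i, the knot λ_k is thus a linear functional of y, represented by `lamVec X i k`.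
These vectors are rescaled Gram-Schmidt vectors: pairwise orthogonal, of norm ρ_k.

The crux is `ihat_eq_iff`: for generic y, the algorithm selects i_1, …, i_{K+1} if and only if the
knots along i satisfy λ_1 ≥ ⋯ ≥ λ_{K+1} > 0 and i_{K+1} wins the last argmax. The order of the knots
alone forces all earlier selections, by a backward induction (`beta_le_lam`).

Let `rest` project away the directions of λ_{a+1}, …, λ_K. It preserves the other knots, by
orthogonality; the last argmax, which sees only P_K^⊥ y; and σ̂_select, since E_1 is orthogonal to
H_{K+1}. So the selection event says that `rest` lies in a fixed set and that λ_a ≥ ⋯ ≥ λ_{K+1}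
(`selection_iff`); the latter is membership of (F_{a+1}, …, F_K) in 𝒟.

Orthogonality makes `rest` independent of these knots, which under the null hypothesis are
independent centred Gaussians with standard deviations σρ_k; their transforms are i.i.d. uniform
(`map_unifKnots`). Since (F_a, F_{K+1}) is a function of `rest`, conditioning only truncates this
uniform law to 𝒟 (`condDistrib_cond_of_indepFun`). -/

namespace LAR

noncomputable section

open scoped RealInnerProductSpace

/-! ### Projections, Gram matrices and the linear form of the knots -/

section Geometry

variable {n p : ℕ}

/-- The signed column of the design that belongs to a signed variable. -/
def svec (X : Matrix (Fin n) (Fin p) ℝ) : SVar p → EuclideanSpace ℝ (Fin n) :=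
  Sum.elim (fun j => WithLp.toLp 2 fun r => X r j) (fun j => -WithLp.toLp 2 fun r => X r j)

/-- The orthogonal projection onto the orthogonal complement of the model space `H_k`. -/
abbrev perp (X : Matrix (Fin n) (Fin p) ℝ) (i : ℕ → SVar p) (k : ℕ) :
    EuclideanSpace ℝ (Fin n) →L[ℝ] EuclideanSpace ℝ (Fin n) :=
  (modelSpace X i k)ᗮ.starProjection

/-- Linear independence of the signed columns of `i₁, …, i_k`. -/
def LI (X : Matrix (Fin n) (Fin p) ℝ) (i : ℕ → SVar p) (k : ℕ) : Prop :=
  LinearIndependent ℝ fun b : Fin k => svec X (i (b + 1))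

/-- The vector of `H_k` whose inner products with the signed columns of `i₁, …, i_k` are the
entries of `c`. -/
def dualVec (X : Matrix (Fin n) (Fin p) ℝ) (i : ℕ → SVar p) (k : ℕ) (c : Fin k → ℝ) :
    EuclideanSpace ℝ (Fin n) :=
  ∑ b : Fin k, ((M X i k)⁻¹.mulVec c) b • svec X (i (b + 1))

/-- The level at which the signed variable `j` is reached after step `k`. -/
def beta (X : Matrix (Fin n) (Fin p) ℝ) (i : ℕ → SVar p) (k : ℕ)
    (y : EuclideanSpace ℝ (Fin n)) (j : SVar p) : ℝ :=
  ⟪svec X j, perp X i k y⟫ / (1 - theta X i k j)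

/-- The knot `λ_k` along a fixed sequence of signed variables. -/
def lam (X : Matrix (Fin n) (Fin p) ℝ) (i : ℕ → SVar p) (k : ℕ)
    (y : EuclideanSpace ℝ (Fin n)) : ℝ :=
  beta X i (k - 1) y (i k)

variable (X : Matrix (Fin n) (Fin p) ℝ) (i : ℕ → SVar p)

lemma inner_toLp_col (j : Fin p) (y : EuclideanSpace ℝ (Fin n)) :
    ⟪(WithLp.toLp 2 fun r => X r j : EuclideanSpace ℝ (Fin n)), y⟫ =
      X.transpose.mulVec (WithLp.ofLp y) j := by
  simp [PiLp.inner_apply, Matrix.mulVec, dotProduct, mul_comm]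

lemma Z_eq_inner (y : EuclideanSpace ℝ (Fin n)) (j : SVar p) : Z X y j = ⟪svec X j, y⟫ := by
  rcases j with j | j
  · simp [Z, svec, inner_toLp_col]
  · simp [Z, svec, inner_toLp_col]

lemma R_eq_inner (j k : SVar p) : R X j k = ⟪svec X j, svec X k⟫ := by
  rcases j with j | j <;> rcases k with k | k <;>
    simp [R, svec, Matrix.fromBlocks, Matrix.mul_apply, inner_toLp_col, Matrix.mulVec,
      dotProduct]

lemma svec_swap (j : SVar p) : svec X j.swap = -svec X j := by
  rcases j with j | j <;> simp [svec]

lemma var_swap (j : SVar p) : SVar.var j.swap = j.var := by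
  rcases j with j | j <;> rfl

lemma svec_eq_or_of_var_eq {j k : SVar p} (h : j.var = k.var) : j = k ∨ j = k.swap := by
  rcases j with j | j <;> rcases k with k | k <;> simp_all [SVar.var]

lemma svec_mem_span_iff (H : Submodule ℝ (EuclideanSpace ℝ (Fin n))) (j : SVar p) :
    svec X j ∈ H ↔ (WithLp.toLp 2 (fun r => X r j.var) : EuclideanSpace ℝ (Fin n)) ∈ H := by
  rcases j with j | j <;> simp [svec, SVar.var]

lemma svec_mem_modelSpace {k l : ℕ} (hl : l ∈ Set.Icc 1 k) :
    svec X (i l) ∈ modelSpace X i k := by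
  rw [svec_mem_span_iff]
  exact Submodule.subset_span ⟨l, hl, rfl⟩

lemma modelSpace_mono {k l : ℕ} (h : k ≤ l) : modelSpace X i k ≤ modelSpace X i l :=
  Submodule.span_mono (Set.image_mono (Set.Icc_subset_Icc_right h))

lemma modelSpace_eq_span (k : ℕ) :
    modelSpace X i k = Submodule.span ℝ (Set.range fun b : Fin k => svec X (i (b + 1))) := by
  apply le_antisymm
  · refine Submodule.span_le.2 ?_
    rintro _ ⟨l, hl, rfl⟩
    refine (svec_mem_span_iff X _ (i l)).1 (Submodule.subset_span ⟨⟨l - 1, ?_⟩, ?_⟩)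
    · have := hl.1; have := hl.2; omega
    · simp [Nat.sub_add_cancel hl.1]
  · refine Submodule.span_le.2 ?_
    rintro _ ⟨b, rfl⟩
    exact svec_mem_modelSpace X i ⟨by omega, by omega⟩

lemma mem_inactive_of_notMem {k : ℕ} {j : SVar p} (h : svec X j ∉ modelSpace X i k) :
    j ∈ inactive i k := by
  intro l hl hlj
  apply h
  rw [svec_mem_span_iff, ← hlj, ← svec_mem_span_iff]
  exact svec_mem_modelSpace X i hl

lemma swap_mem_inactive {k : ℕ} {j : SVar p} (h : j ∈ inactive i k) : j.swap ∈ inactive i k := by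
  intro l hl
  rw [var_swap]
  exact h l hl

lemma inactive_succ {k : ℕ} {j : SVar p} :
    j ∈ inactive i (k + 1) ↔ j ∈ inactive i k ∧ (i (k + 1)).var ≠ j.var := by
  constructor
  · exact fun h => ⟨fun l hl => h l ⟨hl.1, hl.2.trans k.le_succ⟩, h _ ⟨by omega, le_rfl⟩⟩
  · rintro ⟨h1, h2⟩ l ⟨hl1, hl2⟩
    rcases Nat.lt_or_ge k l with h | h
    · obtain rfl : l = k + 1 := by omega
      exact h2
    · exact h1 l ⟨hl1, h⟩

lemma M_eq_gram (k : ℕ) :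
    M X i k = Matrix.gram ℝ fun b : Fin k => svec X (i (b + 1)) := by
  ext b c
  simp [M, R_eq_inner]

lemma LI.mono {k l : ℕ} (h : LI X i l) (hkl : k ≤ l) : LI X i k :=
  h.comp (Fin.castLE hkl) (Fin.castLE_injective hkl)

lemma LI.succ {k : ℕ} (h : LI X i k) (hk : svec X (i (k + 1)) ∉ modelSpace X i k) :
    LI X i (k + 1) := by
  rw [modelSpace_eq_span] at hk
  exact linearIndependent_finSucc'.2 ⟨h, hk⟩

lemma LI.notMem {k : ℕ} (h : LI X i (k + 1)) : svec X (i (k + 1)) ∉ modelSpace X i k := by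
  rw [modelSpace_eq_span]
  exact (linearIndependent_finSucc'.1 h).2

lemma LI_zero : LI X i 0 := linearIndependent_empty_type

lemma inner_dualVec (k : ℕ) (c : Fin k → ℝ) (j : SVar p) :
    ⟪svec X j, dualVec X i k c⟫ = dotProduct (Rrow X i k j) ((M X i k)⁻¹.mulVec c) := by
  simp [dualVec, inner_sum, inner_smul_right, dotProduct, Rrow, R_eq_inner, mul_comm]

lemma dualVec_mem (k : ℕ) (c : Fin k → ℝ) : dualVec X i k c ∈ modelSpace X i k :=
  Submodule.sum_mem _ fun b _ => Submodule.smul_mem _ _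
    (svec_mem_modelSpace X i ⟨by omega, by omega⟩)

/-- Linear independence makes the Gram determinant nonzero, so the formal inverse in `dualVec` is a
true inverse. -/
lemma inner_dualVec_of_LI {k : ℕ} (h : LI X i k) (c : Fin k → ℝ) (b : Fin k) :
    ⟪svec X (i (b + 1)), dualVec X i k c⟫ = c b := by
  have hdet : IsUnit (M X i k).det := by
    rw [M_eq_gram, isUnit_iff_ne_zero]
    exact Matrix.det_gram_ne_zero_iff_linearIndependent.2 h
  rw [inner_dualVec]
  change ((M X i k).mulVec ((M X i k)⁻¹.mulVec c)) b = c b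
  rw [Matrix.mulVec_mulVec, Matrix.mul_nonsing_inv _ hdet, Matrix.one_mulVec]

lemma theta_eq_inner (k : ℕ) (j : SVar p) : theta X i k j = ⟪svec X j, dualVec X i k 1⟫ :=
  (inner_dualVec X i k 1 j).symm

lemma theta_of_LI {k l : ℕ} (h : LI X i k) (hl : l ∈ Set.Icc 1 k) : theta X i k (i l) = 1 := by
  have := inner_dualVec_of_LI X i h 1 ⟨l - 1, by have := hl.1; have := hl.2; omega⟩
  rw [theta_eq_inner]
  simpa [Nat.sub_add_cancel hl.1] using this

lemma theta_zero (j : SVar p) : theta X i 0 j = 0 := by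
  simp [theta, dotProduct]

lemma theta_lt_one {K : ℕ} (hirr : IrrCheck X K i) {k : ℕ} (hk : k ≤ K) {j : SVar p}
    (hj : j ∈ inactive i k) : theta X i k j < 1 := by
  rcases Nat.eq_zero_or_pos k with rfl | h
  · simp [theta_zero]
  · exact hirr.2 k ⟨h, hk⟩ j hj

lemma modelSpace_zero : modelSpace X i 0 = ⊥ := by
  rw [modelSpace_eq_span]
  simp

lemma perp_zero (y : EuclideanSpace ℝ (Fin n)) : perp X i 0 y = y := by
  rw [perp, Submodule.starProjection_orthogonal_val, modelSpace_zero]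
  simp

lemma perp_mem (k : ℕ) (y : EuclideanSpace ℝ (Fin n)) : perp X i k y ∈ (modelSpace X i k)ᗮ :=
  Submodule.starProjection_apply_mem _ _

lemma sub_perp_mem (k : ℕ) (y : EuclideanSpace ℝ (Fin n)) : y - perp X i k y ∈ modelSpace X i k := by
  rw [perp, Submodule.starProjection_orthogonal_val, sub_sub_cancel]
  exact Submodule.starProjection_apply_mem _ _

lemma inner_perp_of_mem {k : ℕ} {v : EuclideanSpace ℝ (Fin n)} (hv : v ∈ modelSpace X i k)
    (y : EuclideanSpace ℝ (Fin n)) : ⟪v, perp X i k y⟫ = 0 :=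
  Submodule.inner_right_of_mem_orthogonal hv (perp_mem X i k y)

lemma inner_perp_comm (k : ℕ) (v y : EuclideanSpace ℝ (Fin n)) :
    ⟪v, perp X i k y⟫ = ⟪perp X i k v, y⟫ :=
  (Submodule.inner_starProjection_left_eq_right _ v y).symm

lemma perp_eq_zero_iff {k : ℕ} {v : EuclideanSpace ℝ (Fin n)} :
    perp X i k v = 0 ↔ v ∈ modelSpace X i k := by
  rw [perp, Submodule.starProjection_apply_eq_zero_iff, Submodule.orthogonal_orthogonal]

/-- An element of `H_k` that is orthogonal to the columns of `H_k` vanishes. -/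
lemma eq_zero_of_inner_eq_zero {k : ℕ} {v : EuclideanSpace ℝ (Fin n)} (hv : v ∈ modelSpace X i k)
    (h : ∀ l ∈ Set.Icc 1 k, ⟪svec X (i l), v⟫ = 0) : v = 0 := by
  have h2 : v ∈ (modelSpace X i k)ᗮ := by
    rw [modelSpace_eq_span, Submodule.mem_orthogonal]
    intro u hu
    induction hu using Submodule.span_induction with
    | mem x hx =>
      obtain ⟨b, rfl⟩ := hx
      exact h _ ⟨by omega, by omega⟩
    | zero => simp
    | add x y _ _ hx hy => simp [inner_add_left, hx, hy]
    | smul c x _ hx => simp [inner_smul_left, hx]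
  exact inner_self_eq_zero.1 (Submodule.inner_right_of_mem_orthogonal hv h2 : ⟪v, v⟫ = 0)

/-- At the level `λ_{k+1}` the residuals before and after the entrance of `i_{k+1}` coincide. -/
lemma perp_add_smul_dualVec {k : ℕ} (hLI : LI X i (k + 1)) {c : ℝ} {y : EuclideanSpace ℝ (Fin n)}
    (hc : ⟪svec X (i (k + 1)), perp X i k y⟫ + c * theta X i k (i (k + 1)) = c) (j : SVar p) :
    ⟪svec X j, perp X i k y⟫ + c * theta X i k j =
      ⟪svec X j, perp X i (k + 1) y⟫ + c * theta X i (k + 1) j := by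
  -- The difference lies in H_{k+1}, so it suffices to test it against the k + 1 columns. Against
  -- the first k both residuals equal c; against the last one this is the hypothesis `hc`.
  have key : (perp X i k y + c • dualVec X i k 1) -
      (perp X i (k + 1) y + c • dualVec X i (k + 1) 1) = 0 := by
    apply eq_zero_of_inner_eq_zero X i (k := k + 1)
    · have h1 := modelSpace_mono X i k.le_succ (sub_perp_mem X i k y)
      have h2 := sub_perp_mem X i (k + 1) y
      have h3 := modelSpace_mono X i k.le_succ (dualVec_mem X i k 1)
      have h4 := dualVec_mem X i (k + 1) 1
      have := Submodule.sub_mem _ (Submodule.add_mem _ (Submodule.sub_mem _ h2 h1)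
        (Submodule.smul_mem _ c h3)) (Submodule.smul_mem _ c h4)
      convert this using 1
      abel
    · intro l hl
      simp only [inner_sub_right, inner_add_right, inner_smul_right, ← theta_eq_inner]
      rw [theta_of_LI X i hLI hl, inner_perp_of_mem X i (svec_mem_modelSpace X i hl)]
      rcases Nat.lt_or_ge k l with h | h
      · obtain rfl : l = k + 1 := by have := hl.2; omega
        rw [hc]; ring
      · rw [theta_of_LI X i (hLI.mono X i k.le_succ) ⟨hl.1, h⟩,
          inner_perp_of_mem X i (svec_mem_modelSpace X i ⟨hl.1, h⟩)]
        ring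
  rw [sub_eq_zero] at key
  have := congrArg (fun v => ⟪svec X j, v⟫) key
  simpa only [inner_add_right, inner_smul_right, ← theta_eq_inner] using this

/-- The direction of the `k`-th knot: the part of the signed column of `i_k` orthogonal to
`H_{k-1}`. -/
def dirVec (k : ℕ) : EuclideanSpace ℝ (Fin n) := perp X i (k - 1) (svec X (i k))

lemma lam_eq (k : ℕ) (y : EuclideanSpace ℝ (Fin n)) :
    lam X i k y = ⟪dirVec X i k, y⟫ / (1 - theta X i (k - 1) (i k)) := by
  rw [lam, beta, dirVec, inner_perp_comm]

lemma dirVec_mem {k l : ℕ} (hk : 1 ≤ k) (hkl : k ≤ l) : dirVec X i k ∈ modelSpace X i l := by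
  have h1 := modelSpace_mono X i (show k - 1 ≤ l by omega) (sub_perp_mem X i (k - 1) (svec X (i k)))
  have h2 := svec_mem_modelSpace X i (show k ∈ Set.Icc 1 l from ⟨hk, hkl⟩)
  simpa [dirVec] using Submodule.sub_mem _ h2 h1

lemma inner_dirVec_of_mem {k l : ℕ} (h : l ≤ k - 1) {v : EuclideanSpace ℝ (Fin n)}
    (hv : v ∈ modelSpace X i l) : ⟪v, dirVec X i k⟫ = 0 :=
  inner_perp_of_mem X i (modelSpace_mono X i h hv) _

lemma inner_dirVec_of_ne {k l : ℕ} (hk : 1 ≤ k) (hl : 1 ≤ l) (h : k ≠ l) :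
    ⟪dirVec X i k, dirVec X i l⟫ = 0 := by
  rcases lt_or_gt_of_ne h with h | h
  · exact inner_dirVec_of_mem X i (l := k) (by omega) (dirVec_mem X i hk le_rfl)
  · rw [real_inner_comm]
    exact inner_dirVec_of_mem X i (l := l) (by omega) (dirVec_mem X i hl le_rfl)

lemma dirVec_ne_zero {K k : ℕ} (hLI : LI X i K) (hk : k ∈ Set.Icc 1 K) : dirVec X i k ≠ 0 := by
  obtain ⟨k, rfl⟩ : ∃ k', k = k' + 1 := ⟨k - 1, by have := hk.1; omega⟩
  rw [dirVec, Ne, perp_eq_zero_iff]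
  exact (hLI.mono X i hk.2).notMem

/-- The radicand is a Schur complement of a Gram matrix, that is, the squared distance from the
column of i_k to H_{k-1}; the vector `dualVec` of the row is the projection of that column. -/
lemma rho_eq {k : ℕ} (hLI : LI X i (k - 1)) :
    rho X i k = ‖dirVec X i k‖ / (1 - theta X i (k - 1) (i k)) := by
  have h : svec X (i k) - dualVec X i (k - 1) (Rrow X i (k - 1) (i k)) = dirVec X i k := by
    rw [← sub_eq_zero]
    apply eq_zero_of_inner_eq_zero X i (k := k - 1)
    · have := Submodule.sub_mem _ (sub_perp_mem X i (k - 1) (svec X (i k)))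
        (dualVec_mem X i (k - 1) (Rrow X i (k - 1) (i k)))
      rw [dirVec]
      convert this using 1
      abel
    · intro l hl
      have h1 := inner_dualVec_of_LI X i hLI (Rrow X i (k - 1) (i k))
        ⟨l - 1, by have := hl.1; have := hl.2; omega⟩
      simp only [Nat.sub_add_cancel hl.1] at h1
      rw [inner_sub_right, inner_dirVec_of_mem X i le_rfl (svec_mem_modelSpace X i hl),
        inner_sub_right, h1, Rrow, R_eq_inner, real_inner_comm]
      simp [Nat.sub_add_cancel hl.1]
  rw [rho]
  congr 1
  have h3 : ⟪dirVec X i k, dirVec X i k⟫ = ⟪svec X (i k), dirVec X i k⟫ := by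
    nth_rewrite 1 [← h]
    rw [inner_sub_left, inner_dirVec_of_mem X i le_rfl (dualVec_mem X i _ _), sub_zero]
  have h2 : R X (i k) (i k) - dotProduct (Rrow X i (k - 1) (i k))
      ((M X i (k - 1))⁻¹.mulVec (Rrow X i (k - 1) (i k))) = ‖dirVec X i k‖ ^ 2 := by
    rw [← real_inner_self_eq_norm_sq, h3, ← h, inner_sub_right, inner_dualVec, R_eq_inner]
  rw [h2, Real.sqrt_sq (norm_nonneg _)]

/-! ### Dependence on the first k entries of the sequence only -/

section Congr

variable {i} {i' : ℕ → SVar p} {k : ℕ}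

lemma modelSpace_congr (h : ∀ l ∈ Set.Icc 1 k, i' l = i l) :
    modelSpace X i' k = modelSpace X i k := by
  unfold modelSpace
  congr 1
  exact Set.image_congr fun l hl => by rw [h l hl]

lemma M_congr (h : ∀ l ∈ Set.Icc 1 k, i' l = i l) : M X i' k = M X i k := by
  ext b c
  simp [M, h (b + 1) ⟨by omega, by omega⟩, h (c + 1) ⟨by omega, by omega⟩]

lemma Rrow_congr (h : ∀ l ∈ Set.Icc 1 k, i' l = i l) (j : SVar p) :
    Rrow X i' k j = Rrow X i k j := by
  ext b
  simp [Rrow, h (b + 1) ⟨by omega, by omega⟩]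

lemma theta_congr (h : ∀ l ∈ Set.Icc 1 k, i' l = i l) (j : SVar p) :
    theta X i' k j = theta X i k j := by
  rw [theta, theta, M_congr X h, Rrow_congr X h]

lemma rho_congr (hk : 1 ≤ k) (h : ∀ l ∈ Set.Icc 1 k, i' l = i l) : rho X i' k = rho X i k := by
  have h' : ∀ l ∈ Set.Icc 1 (k - 1), i' l = i l := fun l hl => h l ⟨hl.1, hl.2.trans (by omega)⟩
  rw [rho, rho, h k ⟨hk, le_rfl⟩, M_congr X h', Rrow_congr X h', theta_congr X h']

lemma inactive_congr (h : ∀ l ∈ Set.Icc 1 k, i' l = i l) : inactive i' k = inactive i k := by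
  ext j
  exact forall₂_congr fun l hl => by rw [h l hl]

lemma E1_congr (h : ∀ l ∈ Set.Icc 1 k, i' l = i l) (n₁ : ℕ) : E1 X i' k n₁ = E1 X i k n₁ := by
  have : projV X i' k = projV X i k := by
    funext ℓ
    simp only [projV, modelSpace_congr X h]
  rw [E1, E1, this]

lemma E1_le (i : ℕ → SVar p) (k n₁ : ℕ) : E1 X i k n₁ ≤ (modelSpace X i k)ᗮ := by
  rintro _ ⟨v, -, rfl⟩
  exact Submodule.starProjection_apply_mem _ _

end Congr

end Geometry

/-! ### The LAR path along a fixed sequence -/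

section Path

variable {n p : ℕ}

section Argmax

variable {tie : Finset (SVar p) → SVar p} {s : Set (SVar p)} {f g : SVar p → ℝ}

lemma exists_isGreatest_image (f : SVar p → ℝ) (hs : s.Nonempty) :
    ∃ m, IsGreatest (f '' s) m := by
  obtain ⟨j, hj, h⟩ := Set.exists_max_image s f s.toFinite hs
  exact ⟨f j, ⟨j, hj, rfl⟩, by rintro _ ⟨j', hj', rfl⟩; exact h j' hj'⟩

lemma argmaxOn_mem (htie : ∀ t, t.Nonempty → tie t ∈ t) (hs : s.Nonempty) :
    argmaxOn tie s f ∈ s ∧ ∀ j ∈ s, f j ≤ f (argmaxOn tie s f) := by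
  classical
  obtain ⟨j, hj, h⟩ := Set.exists_max_image s f s.toFinite hs
  have := htie (Finset.univ.filter fun j => j ∈ s ∧ ∀ j' ∈ s, f j' ≤ f j)
    ⟨j, Finset.mem_filter.2 ⟨Finset.mem_univ _, hj, h⟩⟩
  simp only [Finset.mem_filter, Finset.mem_univ, true_and] at this
  unfold argmaxOn
  convert this

/-- The tie rule sees only the set of maximisers, so two functions with the same maximisers can be
exchanged although they order the other points differently. -/
lemma argmaxOn_congr (h : ∀ j ∈ s, (∀ j' ∈ s, f j' ≤ f j) ↔ ∀ j' ∈ s, g j' ≤ g j) :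
    argmaxOn tie s f = argmaxOn tie s g := by
  unfold argmaxOn
  congr 1
  ext j
  simp only [Finset.mem_filter, Finset.mem_univ, true_and]
  exact and_congr_right fun hj => h j hj

lemma le_iff_eq_of_isGreatest {m : ℝ} (h : IsGreatest (f '' s) m) {j : SVar p} (hj : j ∈ s) :
    (∀ j' ∈ s, f j' ≤ f j) ↔ f j = m := by
  constructor
  · intro h'
    obtain ⟨j', hj', rfl⟩ := h.1
    exact le_antisymm (h.2 ⟨j, hj, rfl⟩) (h' j' hj')
  · intro h' j' hj'
    rw [h']
    exact h.2 ⟨j', hj', rfl⟩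

lemma argmaxOn_eq_of_forall_lt (htie : ∀ t, t.Nonempty → tie t ∈ t) {j : SVar p} (hj : j ∈ s)
    (h : ∀ j' ∈ s, j' ≠ j → f j' < f j) : argmaxOn tie s f = j := by
  obtain ⟨h1, h2⟩ := argmaxOn_mem (f := f) htie ⟨j, hj⟩
  by_contra hne
  exact absurd (h2 j hj) (not_le.2 (h _ h1 hne))

end Argmax

variable (X : Matrix (Fin n) (Fin p) ℝ) (tie : Finset (SVar p) → SVar p) (i : ℕ → SVar p)
  (y : EuclideanSpace ℝ (Fin n))

lemma path_idx_eq_ihat {l m : ℕ} (hl : 1 ≤ l) (hlm : l ≤ m) :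
    (path X tie y m).idx l = ihat X tie y l := by
  induction m, hlm using Nat.le_induction with
  | base => rfl
  | succ m hm ih =>
    obtain ⟨m, rfl⟩ : ∃ m', m = m' + 1 := ⟨m - 1, by omega⟩
    rw [← ih]
    exact Function.update_of_ne (by omega) _ _

/-- The outcome of step `k + 1` of the algorithm when the first `k` selected signed variables are
`i₁, …, i_k`. -/
structure StepOutcome (k : ℕ) : Prop where
  isGreatest : IsGreatest (beta X i k y '' inactive i k) (knot X tie y (k + 1))
  res_eq : ∀ j, (path X tie y (k + 1)).res j =
    ⟪svec X j, perp X i k y⟫ + knot X tie y (k + 1) * theta X i k j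
  ihat_eq : ihat X tie y (k + 1) = argmaxOn tie (inactive i k) (beta X i k y)

lemma beta_zero : beta X i 0 y = Z X y := by
  funext j
  rw [beta, theta_zero, perp_zero, Z_eq_inner, sub_zero, div_one]

lemma inactive_zero : inactive i 0 = Set.univ := by
  ext j
  simp [inactive]

lemma stepOutcome_zero [Nonempty (SVar p)] : StepOutcome X tie i y 0 where
  isGreatest := by
    rw [beta_zero, inactive_zero, Set.image_univ]
    obtain ⟨m, hm⟩ := exists_isGreatest_image (Z X y) Set.univ_nonempty
    rw [Set.image_univ] at hm
    have : knot X tie y 1 = m := hm.csSup_eq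
    rwa [zero_add, this]
  res_eq j := by
    rw [theta_zero, mul_zero, add_zero, perp_zero, ← Z_eq_inner]
    rfl
  ihat_eq := by
    rw [beta_zero, inactive_zero]
    rfl

variable {X tie i y}

lemma StepOutcome.ihat_mem {k : ℕ} (h : StepOutcome X tie i y k)
    (htie : ∀ t, t.Nonempty → tie t ∈ t) (hi : ihat X tie y (k + 1) = i (k + 1)) :
    i (k + 1) ∈ inactive i k ∧ knot X tie y (k + 1) = lam X i (k + 1) y := by
  have hne : (inactive i k).Nonempty := Set.image_nonempty.1 h.isGreatest.nonempty
  have h1 := argmaxOn_mem (f := beta X i k y) htie hne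
  rw [← h.ihat_eq, hi] at h1
  exact ⟨h1.1, ((le_iff_eq_of_isGreatest h.isGreatest h1.1).1 h1.2).symm⟩

/-- The positive level `hpos` makes the set in `nextKnot` nonempty, so that its supremum is a
genuine maximum and not the default value 0. -/
lemma StepOutcome.succ {K k : ℕ} (h : StepOutcome X tie i y k) (hirr : IrrCheck X K i)
    (htie : ∀ t, t.Nonempty → tie t ∈ t) (hk : k + 1 ≤ K) (hLI : LI X i (k + 1))
    (hi : ∀ l ∈ Set.Icc 1 (k + 1), ihat X tie y l = i l)
    (hpos : ∃ j ∈ inactive i (k + 1), 0 < beta X i (k + 1) y j) :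
    StepOutcome X tie i y (k + 1) ∧ knot X tie y (k + 2) ≤ knot X tie y (k + 1) := by
  obtain ⟨hmem, hknot⟩ := h.ihat_mem htie (hi (k + 1) ⟨by omega, le_rfl⟩)
  have hidx : ∀ l ∈ Set.Icc 1 (k + 1), (path X tie y (k + 1)).idx l = i l := fun l hl => by
    rw [path_idx_eq_ihat X tie y hl.1 hl.2, hi l hl]
  have hinact : inactive (path X tie y (k + 1)).idx (k + 1) = inactive i (k + 1) :=
    inactive_congr hidx
  have hc : ⟪svec X (i (k + 1)), perp X i k y⟫ +
      knot X tie y (k + 1) * theta X i k (i (k + 1)) = knot X tie y (k + 1) := by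
    have h1 := theta_lt_one X i hirr (by omega : k ≤ K) hmem
    rw [hknot, lam, beta, Nat.add_sub_cancel]
    field_simp [(sub_pos.2 h1).ne']
    ring
  have htrans := perp_add_smul_dualVec X i hLI hc
  have hres : ∀ b j, resAt X (k + 1) (path X tie y (k + 1)) b j =
      ⟪svec X j, perp X i (k + 1) y⟫ + b * theta X i (k + 1) j := by
    intro b j
    rw [resAt, h.res_eq, htrans, theta_congr X hidx, ← knot]
    ring
  have hth : ∀ j ∈ inactive i (k + 1), 0 < 1 - theta X i (k + 1) j := fun j hj =>
    sub_pos.2 (theta_lt_one X i hirr hk hj)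
  have hA : ∀ j ∈ inactive i (k + 1), ⟪svec X j, perp X i (k + 1) y⟫ =
      beta X i (k + 1) y j * (1 - theta X i (k + 1) j) := fun j hj => by
    rw [beta, div_mul_cancel₀ _ (hth j hj).ne']
  -- At level λ_{k+1} the residuals relative to H_k and to H_{k+1} agree. Both `beta` bounds
  -- therefore express the same inequality: the residual of j is at most λ_{k+1}.
  have hle : ∀ j ∈ inactive i (k + 1), beta X i (k + 1) y j ≤ knot X tie y (k + 1) := by
    intro j hj
    have hj' := ((inactive_succ i).1 hj).1
    have h1 := theta_lt_one X i hirr (by omega : k ≤ K) hj'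
    have h2 := h.isGreatest.2 ⟨j, hj', rfl⟩
    rw [beta, div_le_iff₀ (sub_pos.2 h1)] at h2
    rw [beta, div_le_iff₀ (hth j hj)]
    linarith [htrans j]
  obtain ⟨j₀, hj₀, hj₀pos⟩ := hpos
  obtain ⟨m, hm⟩ := exists_isGreatest_image (beta X i (k + 1) y) ⟨j₀, hj₀⟩
  have hmpos : 0 < m := hj₀pos.trans_le (hm.2 ⟨j₀, hj₀, rfl⟩)
  have hnext : nextKnot X (k + 1) (path X tie y (k + 1)) = m := by
    refine IsGreatest.csSup_eq ⟨?_, ?_⟩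
    · obtain ⟨j, hj, rfl⟩ := hm.1
      refine ⟨hmpos, hle j hj, j, hinact ▸ hj, ?_⟩
      rw [hres, hA j hj]
      ring
    · rintro b ⟨-, -, j, hj, hb⟩
      rw [hinact] at hj
      rw [hres, hA j hj] at hb
      have : beta X i (k + 1) y j = b :=
        mul_right_cancel₀ (hth j hj).ne' (by linarith)
      exact this ▸ hm.2 ⟨j, hj, rfl⟩
  have hkn : knot X tie y (k + 2) = m := hnext
  refine ⟨⟨by rwa [hkn], fun j => ?_, ?_⟩, ?_⟩
  · rw [hkn, ← hres, ← hnext]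
    rfl
  · have h1 : ihat X tie y (k + 1 + 1) =
        argmaxOn tie (inactive (path X tie y (k + 1)).idx (k + 1))
          (resAt X (k + 1) (path X tie y (k + 1))
            (nextKnot X (k + 1) (path X tie y (k + 1)))) :=
      Function.update_self ..
    rw [h1, hinact, hnext]
    -- Residuals at level m and values of `beta` differ by j-dependent factors, but both reach their
    -- common maximum m at the same variables.
    have hiff : ∀ j ∈ inactive i (k + 1), (resAt X (k + 1) (path X tie y (k + 1)) m j = m ↔
        beta X i (k + 1) y j = m) := by
      intro j hj
      rw [hres, hA j hj]
      constructor
      · exact fun h => mul_right_cancel₀ (hth j hj).ne' (by linarith)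
      · intro h
        rw [h]
        ring
    have hm' : IsGreatest (resAt X (k + 1) (path X tie y (k + 1)) m '' inactive i (k + 1)) m := by
      constructor
      · obtain ⟨j, hj, hjm⟩ := hm.1
        exact ⟨j, hj, (hiff j hj).2 hjm⟩
      · rintro _ ⟨j, hj, rfl⟩
        have := mul_le_mul_of_nonneg_right (hm.2 ⟨j, hj, rfl⟩) (hth j hj).le
        rw [hres, hA j hj]
        linarith
    refine argmaxOn_congr fun j hj => ?_
    rw [le_iff_eq_of_isGreatest hm hj, le_iff_eq_of_isGreatest hm' hj, hiff j hj]
  · rw [hkn]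
    obtain ⟨j, hj, rfl⟩ := hm.1
    exact hle j hj

variable (X i y) in
/-- The response `y` avoids finitely many hyperplanes. -/
def Generic (K : ℕ) : Prop :=
  (∀ k ≤ K, ∀ j, svec X j ∉ modelSpace X i k → ⟪perp X i k (svec X j), y⟫ ≠ 0) ∧
  (LI X i (K + 1) → ∀ k ∈ Set.Icc 1 K, lam X i k y ≠ lam X i (k + 1) y)

lemma exists_svec_notMem {k : ℕ} (h : k < X.rank) : ∃ j, svec X j ∉ modelSpace X i k := by
  by_contra! hall
  have h1 : Submodule.span ℝ (Set.range fun j : Fin p =>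
      (WithLp.toLp 2 (X.col j) : EuclideanSpace ℝ (Fin n))) ≤ modelSpace X i k := by
    refine Submodule.span_le.2 ?_
    rintro _ ⟨j, rfl⟩
    exact hall (Sum.inl j)
  have h2 := Submodule.finrank_mono h1
  have h3 : Module.finrank ℝ (modelSpace X i k) ≤ k := by
    rw [modelSpace_eq_span]
    exact (finrank_range_le_card _).trans (by simp)
  have h4 : Module.finrank ℝ (Submodule.span ℝ (Set.range fun j : Fin p =>
      (WithLp.toLp 2 (X.col j) : EuclideanSpace ℝ (Fin n)))) = X.rank := by
    rw [Matrix.rank_eq_finrank_span_cols]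
    have : Set.range (fun j : Fin p => (WithLp.toLp 2 (X.col j) : EuclideanSpace ℝ (Fin n))) =
        (WithLp.linearEquiv 2 ℝ (Fin n → ℝ)).symm '' Set.range X.col := by
      rw [← Set.range_comp]
      rfl
    rw [this]
    have h5 := Submodule.map_span
      ((WithLp.linearEquiv 2 ℝ (Fin n → ℝ)).symm : (Fin n → ℝ) →ₗ[ℝ] WithLp 2 (Fin n → ℝ))
      (Set.range X.col)
    simp only [LinearEquiv.coe_coe] at h5
    erw [← h5]
    exact LinearEquiv.finrank_map_eq _ _
  exact absurd (h4.symm.trans_le (h2.trans h3)) (not_le.2 h)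

/-- The two signs of a column outside H_k have opposite nonzero numerators and positive
denominators, so one of the two levels is positive. -/
lemma exists_beta_pos {K k : ℕ} (hirr : IrrCheck X K i) (hk : k ≤ K) (hr : k < X.rank)
    (hgen : Generic X i y K) : ∃ j ∈ inactive i k, 0 < beta X i k y j := by
  obtain ⟨j, hj⟩ := exists_svec_notMem (i := i) hr
  have hin := mem_inactive_of_notMem X i hj
  have h0 := hgen.1 k hk j hj
  rw [← inner_perp_comm] at h0
  have h1 := theta_lt_one X i hirr hk hin
  have h2 := theta_lt_one X i hirr hk (swap_mem_inactive i hin)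
  rcases lt_or_gt_of_ne h0 with h | h
  · refine ⟨j.swap, swap_mem_inactive i hin, div_pos ?_ (sub_pos.2 h2)⟩
    rw [svec_swap, inner_neg_left]
    linarith
  · exact ⟨j, hin, div_pos h (sub_pos.2 h1)⟩

/-- If the algorithm selects `i₁, …, i_{K+1}` on a generic response, then its steps are described
by the functions `beta` along `i`. -/
lemma stepOutcome_of_ihat_eq {K : ℕ} (hirr : IrrCheck X K i) (hr : K < X.rank)
    (htie : ∀ t, t.Nonempty → tie t ∈ t) (hgen : Generic X i y K)
    (hi : ∀ l ∈ Set.Icc 1 (K + 1), ihat X tie y l = i l) {k : ℕ} (hk : k ≤ K) :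
    StepOutcome X tie i y k ∧ LI X i (k + 1) ∧ 0 < knot X tie y (k + 1) ∧
      (1 ≤ k → knot X tie y (k + 1) ≤ knot X tie y k) := by
  -- Linear independence is not part of the Irrepresentable Check: it is forced by the selection. A
  -- column of i_{k+1} inside H_k would give the knot the value 0, while some inactive level is
  -- positive.
  have main : ∀ k ≤ K, LI X i k → StepOutcome X tie i y k →
      LI X i (k + 1) ∧ 0 < knot X tie y (k + 1) := by
    intro k hk hLI h
    obtain ⟨j, hj, hpos⟩ := exists_beta_pos hirr hk (by omega) hgen
    have h0 : 0 < knot X tie y (k + 1) := hpos.trans_le (h.isGreatest.2 ⟨j, hj, rfl⟩)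
    refine ⟨hLI.succ X i fun hmem => ?_, h0⟩
    rw [(h.ihat_mem htie (hi (k + 1) ⟨by omega, by omega⟩)).2, lam, beta, Nat.add_sub_cancel,
      inner_perp_of_mem X i hmem] at h0
    simp at h0
  induction k with
  | zero =>
    have : Nonempty (SVar p) := (exists_svec_notMem (X := X) (i := i) hr).nonempty
    have h := stepOutcome_zero X tie i y
    obtain ⟨h1, h2⟩ := main 0 hk (LI_zero X i) h
    exact ⟨h, h1, h2, by omega⟩
  | succ k ih =>
    obtain ⟨h, hLI, hpos, -⟩ := ih (by omega)
    obtain ⟨h', hle⟩ := h.succ hirr htie hk hLI (fun l hl => hi l ⟨hl.1, hl.2.trans (by omega)⟩)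
      (exists_beta_pos hirr hk (by omega) hgen)
    obtain ⟨h1, h2⟩ := main (k + 1) hk hLI h'
    exact ⟨h', h1, h2, fun _ => hle⟩

/-- The knots along `i` dominate the levels of the inactive variables. -/
lemma beta_le_lam {K : ℕ} (hirr : IrrCheck X K i) (hLI : LI X i (K + 1))
    (htie : ∀ t, t.Nonempty → tie t ∈ t) (hpos : 0 < lam X i (K + 1) y)
    (hanti : ∀ k ∈ Set.Icc 1 K, lam X i (k + 1) y < lam X i k y)
    (harg : argmaxOn tie (inactive i K) (beta X i K y) = i (K + 1)) {k : ℕ} (hk : k ≤ K) :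
    0 < lam X i (k + 1) y ∧ ∀ j ∈ inactive i k, beta X i k y j ≤ lam X i (k + 1) y ∧
      (k < K → j ≠ i (k + 1) → beta X i k y j < lam X i (k + 1) y) := by
  induction hk using Nat.decreasingInduction with
  | self =>
    refine ⟨hpos, fun j hj => ⟨?_, by omega⟩⟩
    have := (argmaxOn_mem (f := beta X i K y) htie ⟨j, hj⟩).2 j hj
    rwa [harg] at this
  | of_succ k hk ih =>
    have hlt := hanti (k + 1) ⟨by omega, hk⟩
    have h0 : 0 < lam X i (k + 1) y := ih.1.trans hlt
    have hmem : i (k + 1) ∈ inactive i k :=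
      mem_inactive_of_notMem X i (hLI.mono X i (by omega : k + 1 ≤ K + 1)).notMem
    have hth := sub_pos.2 (theta_lt_one X i hirr hk.le hmem)
    have hc : ⟪svec X (i (k + 1)), perp X i k y⟫ +
        lam X i (k + 1) y * theta X i k (i (k + 1)) = lam X i (k + 1) y := by
      rw [lam, beta, Nat.add_sub_cancel]
      field_simp [hth.ne']
      ring
    have key : ∀ j ∈ inactive i k, j ≠ i (k + 1) → beta X i k y j < lam X i (k + 1) y := by
      intro j hj hne
      have hthj := sub_pos.2 (theta_lt_one X i hirr hk.le hj)
      -- The only variable inactive at step k but not at step k + 1 is that of i_{k+1}. Its opposite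
      -- sign has a negative numerator, hence a level below λ_{k+1}.
      by_cases hvar : (i (k + 1)).var = j.var
      · obtain rfl : j = (i (k + 1)).swap :=
          (svec_eq_or_of_var_eq hvar.symm).resolve_left hne
        rw [beta, div_lt_iff₀ hthj, svec_swap, inner_neg_left]
        have h1 := mul_pos h0 hth
        have h2 := mul_pos h0 hthj
        linarith
      · have hj' : j ∈ inactive i (k + 1) := (inactive_succ i).2 ⟨hj, hvar⟩
        have hth' := sub_pos.2 (theta_lt_one X i hirr hk hj')
        have h1 := ((ih.2 j hj').1).trans_lt hlt
        rw [beta, div_lt_iff₀ hth'] at h1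
        rw [beta, div_lt_iff₀ hthj]
        linarith [perp_add_smul_dualVec X i (hLI.mono X i (by omega)) hc j]
    refine ⟨h0, fun j hj => ⟨?_, fun _ => key j hj⟩⟩
    by_cases hne : j = i (k + 1)
    · rw [hne, lam, Nat.add_sub_cancel]
    · exact (key j hj hne).le

/-- The algorithm selects `i₁, …, i_{K+1}` as soon as the knots along `i` decrease and `i_{K+1}`
is selected among the maximisers at the last step. -/
lemma ihat_eq_of_lam_anti {K : ℕ} (hirr : IrrCheck X K i) (hr : K < X.rank)
    (hLI : LI X i (K + 1)) (htie : ∀ t, t.Nonempty → tie t ∈ t)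
    (hpos : 0 < lam X i (K + 1) y)
    (hanti : ∀ k ∈ Set.Icc 1 K, lam X i (k + 1) y < lam X i k y)
    (harg : argmaxOn tie (inactive i K) (beta X i K y) = i (K + 1)) :
    ∀ l ∈ Set.Icc 1 (K + 1), ihat X tie y l = i l := by
  have hmem : ∀ k ≤ K, i (k + 1) ∈ inactive i k := fun k hk =>
    mem_inactive_of_notMem X i (hLI.mono X i (by omega : k + 1 ≤ K + 1)).notMem
  have hsel : ∀ k ≤ K, StepOutcome X tie i y k → ihat X tie y (k + 1) = i (k + 1) := by
    intro k hk h
    rw [h.ihat_eq]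
    -- Before the last step the maximiser is unique; only at step K can the tie rule intervene.
    rcases hk.lt_or_eq with hlt | rfl
    · refine argmaxOn_eq_of_forall_lt htie (hmem k hk) fun j hj hne => ?_
      have := ((beta_le_lam hirr hLI htie hpos hanti harg hk).2 j hj).2 hlt hne
      rwa [lam, Nat.add_sub_cancel] at this
    · exact harg
  have main : ∀ k ≤ K, StepOutcome X tie i y k ∧
      ∀ l ∈ Set.Icc 1 (k + 1), ihat X tie y l = i l := by
    intro k hk
    induction k with
    | zero =>
      have : Nonempty (SVar p) := (exists_svec_notMem (X := X) (i := i) hr).nonempty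
      have h := stepOutcome_zero X tie i y
      refine ⟨h, fun l hl => ?_⟩
      obtain rfl : l = 0 + 1 := by have := hl.1; have := hl.2; omega
      exact hsel 0 hk h
    | succ k ih =>
      obtain ⟨h, hi⟩ := ih (by omega)
      have hpos' : 0 < beta X i (k + 1) y (i (k + 2)) :=
        (beta_le_lam hirr hLI htie hpos hanti harg hk).1
      have h' := (h.succ hirr htie hk (hLI.mono X i (by omega)) hi
        ⟨_, hmem (k + 1) hk, hpos'⟩).1
      refine ⟨h', fun l hl => ?_⟩
      rcases Nat.lt_or_ge l (k + 2) with hlt | hge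
      · exact hi l ⟨hl.1, by omega⟩
      · obtain rfl : l = k + 1 + 1 := by have := hl.2; omega
        exact hsel (k + 1) hk h'
  exact (main K le_rfl).2

end Path

/-! ### The Gaussian CDF and the probability integral transform -/

section GaussianCdf

variable {s : ℝ}

lemma toNNReal_sq_ne_zero (hs : s ≠ 0) : (s ^ 2).toNNReal ≠ 0 := by
  rw [Ne, Real.toNNReal_eq_zero, not_le]
  positivity

lemma Phi_strictMono (hs : s ≠ 0) : StrictMono (Phi s) := by
  have : (gaussianReal 0 (s ^ 2).toNNReal).IsOpenPosMeasure :=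
    (gaussianReal_absolutelyContinuous' 0 (toNNReal_sq_ne_zero hs)).isOpenPosMeasure
  intro x y hxy
  have h : 0 < (cdf (gaussianReal 0 (s ^ 2).toNNReal)).measure (Set.Ioc x y) := by
    rw [measure_cdf]
    exact (isOpen_Ioo.measure_pos _ (Set.nonempty_Ioo.2 hxy)).trans_le
      (measure_mono Set.Ioo_subset_Ioc_self)
  rw [StieltjesFunction.measure_Ioc] at h
  exact sub_pos.1 (ENNReal.ofReal_pos.1 h)

lemma Phi_continuous (hs : s ≠ 0) : Continuous (Phi s) := by
  have := nullSingletonClass_gaussianReal (μ := 0) (toNNReal_sq_ne_zero hs)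
  refine continuous_iff_continuousAt.2 fun x => ?_
  have hmono := monotone_cdf (gaussianReal 0 (s ^ 2).toNNReal)
  refine (hmono.continuousAt_iff_leftLim_eq_rightLim).2 ?_
  rw [StieltjesFunction.rightLim_eq]
  have h : (cdf (gaussianReal 0 (s ^ 2).toNNReal)).measure {x} = 0 := by
    rw [measure_cdf]
    exact measure_singleton x
  rw [StieltjesFunction.measure_singleton, ENNReal.ofReal_eq_zero, sub_nonpos] at h
  exact le_antisymm (hmono.leftLim_le le_rfl) h

lemma Phi_mem_Ioo (hs : s ≠ 0) (x : ℝ) : Phi s x ∈ Set.Ioo (0 : ℝ) 1 :=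
  ⟨(cdf_nonneg _ (x - 1)).trans_lt (Phi_strictMono hs (by linarith)),
    (Phi_strictMono hs (show x < x + 1 by linarith)).trans_le (cdf_le_one _ (x + 1))⟩

lemma Phi_surjOn (hs : s ≠ 0) {u : ℝ} (hu : u ∈ Set.Ioo (0 : ℝ) 1) : ∃ x, Phi s x = u :=
  mem_range_of_exists_le_of_exists_ge (Phi_continuous hs)
    (((tendsto_cdf_atBot (gaussianReal 0 (s ^ 2).toNNReal)).eventually_lt_const hu.1).exists.imp
      fun _ h => h.le)
    (((tendsto_cdf_atTop (gaussianReal 0 (s ^ 2).toNNReal)).eventually_const_lt hu.2).exists.imp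
      fun _ h => h.le)

lemma invFun_Phi (hs : s ≠ 0) (x : ℝ) : Function.invFun (Phi s) (Phi s x) = x :=
  Function.leftInverse_invFun (Phi_strictMono hs).injective x

lemma Phi_invFun (hs : s ≠ 0) {u : ℝ} (hu : u ∈ Set.Ioo (0 : ℝ) 1) :
    Phi s (Function.invFun (Phi s) u) = u :=
  Function.invFun_eq (Phi_surjOn hs hu)

lemma measurable_invFun_Phi (hs : s ≠ 0) : Measurable (Function.invFun (Phi s)) := by
  refine measurable_of_Iic fun x => ?_
  -- On (0,1) the inverse is the true one; outside the range of the CDF it takes a fixed arbitrary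
  -- value.
  have h : Function.invFun (Phi s) ⁻¹' Set.Iic x = (Set.Ioo 0 1 ∩ Set.Iic (Phi s x)) ∪
      ((Set.Ioo 0 1)ᶜ ∩ {_u | Classical.arbitrary ℝ ≤ x}) := by
    ext u
    by_cases hu : u ∈ Set.Ioo (0 : ℝ) 1
    · simp only [Set.mem_preimage, Set.mem_Iic, Set.mem_union, Set.mem_inter_iff, hu, true_and,
        Set.mem_compl_iff, not_true_eq_false, false_and, or_false]
      rw [← (Phi_strictMono hs).le_iff_le, Phi_invFun hs hu]
    · have h : ¬ ∃ x, Phi s x = u := by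
        rintro ⟨x, rfl⟩
        exact hu (Phi_mem_Ioo hs x)
      simp [hu, Function.invFun_neg h]
  rw [h]
  exact (measurableSet_Ioo.inter measurableSet_Iic).union
    (measurableSet_Ioo.compl.inter (MeasurableSet.const _))

lemma map_Phi_gaussianReal (hs : s ≠ 0) :
    (gaussianReal 0 (s ^ 2).toNNReal).map (Phi s) = volume.restrict (Set.Ioo (0 : ℝ) 1) := by
  have hm : Measurable (Phi s) := (Phi_continuous hs).measurable
  have : IsProbabilityMeasure ((gaussianReal 0 (s ^ 2).toNNReal).map (Phi s)) :=
    Measure.isProbabilityMeasure_map hm.aemeasurable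
  refine Measure.ext_of_Iic _ _ fun u => ?_
  rw [Measure.map_apply hm measurableSet_Iic, Measure.restrict_apply measurableSet_Iic]
  rcases le_or_gt u 0 with h0 | h0
  · have h1 : Phi s ⁻¹' Set.Iic u = ∅ :=
      Set.eq_empty_of_forall_notMem fun x hx => absurd (Phi_mem_Ioo hs x).1 (not_lt.2 (hx.trans h0))
    have h2 : Set.Iic u ∩ Set.Ioo (0 : ℝ) 1 = ∅ :=
      Set.eq_empty_of_forall_notMem fun x hx => absurd hx.2.1 (not_lt.2 (hx.1.trans h0))
    rw [h1, h2, measure_empty, measure_empty]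
  rcases lt_or_ge u 1 with h1 | h1
  · obtain ⟨x, rfl⟩ := Phi_surjOn hs ⟨h0, h1⟩
    have h2 : Phi s ⁻¹' Set.Iic (Phi s x) = Set.Iic x := by
      ext y
      exact (Phi_strictMono hs).le_iff_le
    have h3 : Set.Iic (Phi s x) ∩ Set.Ioo (0 : ℝ) 1 = Set.Ioc 0 (Phi s x) := by
      ext y
      exact ⟨fun h => ⟨h.2.1, h.1⟩, fun h => ⟨h.2, h.1, h.2.trans_lt h1⟩⟩
    rw [h2, h3, Real.volume_Ioc, sub_zero, Phi, ofReal_cdf]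
  · have h2 : Phi s ⁻¹' Set.Iic u = Set.univ :=
      Set.eq_univ_of_forall fun x => (Phi_mem_Ioo hs x).2.le.trans h1
    have h3 : Set.Iic u ∩ Set.Ioo (0 : ℝ) 1 = Set.Ioo 0 1 :=
      Set.inter_eq_right.2 fun y hy => hy.2.le.trans h1
    rw [h2, h3, measure_univ, Real.volume_Ioo]
    simp

end GaussianCdf

/-! ### Conditioning independent variables on a parametrised set -/

section Conditional

variable {Ω U V E : Type*} [MeasurableSpace Ω] [MeasurableSpace U] [MeasurableSpace V]
  [MeasurableSpace E]

/-- The kernel that conditions a finite measure on a measurable family of sets. -/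
def condKernel (η : Measure E) [IsFiniteMeasure η] (D : V → Set E)
    (hD : MeasurableSet {q : V × E | q.2 ∈ D q.1}) : Kernel V E where
  toFun v := cond η (D v)
  measurable' := by
    refine Measure.measurable_of_measurable_coe _ fun t ht => ?_
    simp only [cond_apply' ht]
    refine (measurable_measure_prodMk_left hD).inv.mul ?_
    exact measurable_measure_prodMk_left (hD.inter (measurable_snd ht))

lemma condKernel_apply (η : Measure E) [IsFiniteMeasure η] (D : V → Set E)
    (hD : MeasurableSet {q : V × E | q.2 ∈ D q.1}) (v : V) : condKernel η D hD v = cond η (D v) :=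
  rfl

/-- The kernel need not be Markov: `cond` is the zero measure where D v is null. -/
instance (η : Measure E) [IsFiniteMeasure η] (D : V → Set E)
    (hD : MeasurableSet {q : V × E | q.2 ∈ D q.1}) : IsFiniteKernel (condKernel η D hD) := by
  refine ⟨⟨1, ENNReal.one_lt_top, fun v => ?_⟩⟩
  rw [condKernel_apply, cond_apply' MeasurableSet.univ, Set.inter_univ]
  exact ENNReal.inv_mul_le_one _

/-- If `L` is independent of `u`, then conditionally on an event of the form
`{u ∈ G, L ∈ D (h u)}` and on `h u`, the law of `L` is its unconditional law restricted to
`D (h u)` and normalised. -/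
theorem condDistrib_cond_of_indepFun [StandardBorelSpace E] [Nonempty E] {Pr : Measure Ω}
    [IsProbabilityMeasure Pr] {u : Ω → U} {L : Ω → E} (hu : Measurable u) (hL : Measurable L)
    (hind : IndepFun u L Pr) {h : U → V} (hh : Measurable h) {G : Set U} (hG : MeasurableSet G)
    {D : V → Set E} (hD : MeasurableSet {q : V × E | q.2 ∈ D q.1}) :
    ∀ᵐ ω ∂(cond Pr {ω | u ω ∈ G ∧ L ω ∈ D (h (u ω))}),
      condDistrib L (fun ω => h (u ω)) (cond Pr {ω | u ω ∈ G ∧ L ω ∈ D (h (u ω))}) (h (u ω)) =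
        cond (Pr.map L) (D (h (u ω))) := by
  set A := {ω | u ω ∈ G ∧ L ω ∈ D (h (u ω))} with hA
  have : IsProbabilityMeasure (Pr.map L) := Measure.isProbabilityMeasure_map hL.aemeasurable
  have : IsProbabilityMeasure (Pr.map u) := Measure.isProbabilityMeasure_map hu.aemeasurable
  have hprod : Pr.map (fun ω => (u ω, L ω)) = (Pr.map u).prod (Pr.map L) :=
    (indepFun_iff_map_prod_eq_prod_map_map hu.aemeasurable hL.aemeasurable).1 hind
  have huL : Measurable fun ω => (u ω, L ω) := hu.prodMk hL
  have hhu : Measurable fun ω => h (u ω) := hh.comp hu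
  have hDh : MeasurableSet {q : U × E | q.2 ∈ D (h q.1)} :=
    ((hh.comp measurable_fst).prodMk measurable_snd) hD
  have hAm : MeasurableSet A := (hu hG).inter (huL hDh)
  -- The joint law on A is disintegrated before normalisation. On rectangles, independence and
  -- Fubini reduce the claim to the pointwise identity η(D ∩ t) = η(D) · cond η D t, with η the law
  -- of L.
  have key : (Pr.restrict A).map (fun ω => (h (u ω), L ω)) =
      (Pr.restrict A).map (fun ω => h (u ω)) ⊗ₘ condKernel (Pr.map L) D hD := by
    refine Measure.ext_prod fun {s t} hs ht => ?_
    have hB : MeasurableSet {q : U × E | (q.1 ∈ G ∧ h q.1 ∈ s) ∧ q.2 ∈ D (h q.1)} :=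
      (measurable_fst (hG.inter (hh hs))).inter hDh
    have hκ : Measurable fun v => condKernel (Pr.map L) D hD v t := Kernel.measurable_coe _ ht
    have h1 : (Pr.restrict A).map (fun ω => (h (u ω), L ω)) (s ×ˢ t) =
        ∫⁻ x, Pr.map L (Prod.mk x ⁻¹'
          ({q : U × E | (q.1 ∈ G ∧ h q.1 ∈ s) ∧ q.2 ∈ D (h q.1)} ∩ Prod.snd ⁻¹' t))
          ∂(Pr.map u) := by
      rw [← Measure.prod_apply (hB.inter (measurable_snd ht)), ← hprod,
        Measure.map_apply huL (hB.inter (measurable_snd ht)),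
        Measure.map_apply (hhu.prodMk hL) (hs.prod ht),
        Measure.restrict_apply ((hhu.prodMk hL) (hs.prod ht))]
      congr 1
      ext ω
      simp only [hA, Set.mem_inter_iff, Set.mem_preimage, Set.mem_prod, Set.mem_ofPred_eq]
      tauto
    have h2 : ((Pr.restrict A).map (fun ω => h (u ω)) ⊗ₘ condKernel (Pr.map L) D hD) (s ×ˢ t) =
        ∫⁻ x, condKernel (Pr.map L) D hD (h x) t * Pr.map L (Prod.mk x ⁻¹'
          {q : U × E | (q.1 ∈ G ∧ h q.1 ∈ s) ∧ q.2 ∈ D (h q.1)}) ∂(Pr.map u) := by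
      have hf : Measurable fun q : U × E => condKernel (Pr.map L) D hD (h q.1) t :=
        hκ.comp (hh.comp measurable_fst)
      rw [Measure.compProd_apply_prod hs ht, setLIntegral_map hs hκ hhu,
        Measure.restrict_restrict (hhu hs)]
      have h3 : (fun ω => h (u ω)) ⁻¹' s ∩ A = (fun ω => (u ω, L ω)) ⁻¹'
          {q : U × E | (q.1 ∈ G ∧ h q.1 ∈ s) ∧ q.2 ∈ D (h q.1)} := by
        ext ω
        simp only [hA, Set.mem_inter_iff, Set.mem_preimage, Set.mem_ofPred_eq]
        tauto
      rw [h3, ← setLIntegral_map hB hf huL, hprod, ← lintegral_indicator hB,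
        lintegral_prod _ (hf.indicator hB).aemeasurable]
      refine lintegral_congr fun x => ?_
      rw [← lintegral_indicator_const (measurable_prodMk_left hB)]
      rfl
    rw [h1, h2]
    refine lintegral_congr fun x => ?_
    rw [condKernel_apply, cond_apply' ht]
    by_cases hx : x ∈ G ∧ h x ∈ s
    · have h3 : Prod.mk x ⁻¹' {q : U × E | (q.1 ∈ G ∧ h q.1 ∈ s) ∧ q.2 ∈ D (h q.1)} =
          D (h x) := by
        ext l
        simp [hx]
      rw [Set.preimage_inter, h3]
      change Pr.map L (D (h x) ∩ t) = _
      -- When D is null both sides vanish, so the default value of `cond` does no harm.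
      by_cases h0 : Pr.map L (D (h x)) = 0
      · rw [measure_mono_null Set.inter_subset_left h0, h0, mul_zero]
      · rw [mul_right_comm, ENNReal.inv_mul_cancel h0 (measure_ne_top _ _), one_mul]
    · have h3 : Prod.mk x ⁻¹' {q : U × E | (q.1 ∈ G ∧ h q.1 ∈ s) ∧ q.2 ∈ D (h q.1)} = ∅ := by
        ext l
        simp [hx]
      rw [Set.preimage_inter, h3, Set.empty_inter, measure_empty, mul_zero]
  have key' : (cond Pr A).map (fun ω => (h (u ω), L ω)) =
      (cond Pr A).map (fun ω => h (u ω)) ⊗ₘ condKernel (Pr.map L) D hD := by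
    rw [ProbabilityTheory.cond, Measure.map_smul, Measure.map_smul, key,
      Measure.compProd_smul_left]
  exact ae_of_ae_map hhu.aemeasurable
    (condDistrib_ae_eq_of_measure_eq_compProd _ hL.aemeasurable key')

end Conditional

/-! ### Linear functionals of an isotropic Gaussian vector -/

section GaussianVector

variable {n : ℕ} {Ω : Type*} [MeasurableSpace Ω] {Pr : Measure Ω}
  {Y : Ω → EuclideanSpace ℝ (Fin n)} {μ : EuclideanSpace ℝ (Fin n)} {σ : ℝ}

lemma posSemidef_sq_smul_one (n : ℕ) (σ : ℝ) :
    (σ ^ 2 • (1 : Matrix (Fin n) (Fin n) ℝ)).PosSemidef :=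
  Matrix.PosSemidef.one.smul (sq_nonneg σ)

lemma covariance_inner (hY : HasLaw Y (multivariateGaussian μ
    (σ ^ 2 • (1 : Matrix (Fin n) (Fin n) ℝ))) Pr) (x y : EuclideanSpace ℝ (Fin n)) :
    cov[fun ω => ⟪x, Y ω⟫, fun ω => ⟪y, Y ω⟫; Pr] = σ ^ 2 * ⟪x, y⟫ := by
  have h := covarianceBilin_multivariateGaussian (μ := μ) (posSemidef_sq_smul_one n σ) x y
  rw [covarianceBilin_apply_eq_cov IsGaussian.memLp_two_id, ← hY.map_eq,
    covariance_map (by fun_prop) (by fun_prop) hY.aemeasurable] at h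
  refine h.trans ?_
  simp only [Matrix.smul_mulVec, Matrix.one_mulVec, PiLp.inner_apply, dotProduct, Pi.smul_apply,
    smul_eq_mul, Finset.mul_sum, RCLike.inner_apply, conj_trivial]
  exact Finset.sum_congr rfl fun _ _ => by ring

lemma hasLaw_inner (hY : HasLaw Y (multivariateGaussian μ
    (σ ^ 2 • (1 : Matrix (Fin n) (Fin n) ℝ))) Pr) (v : EuclideanSpace ℝ (Fin n)) :
    Pr.map (fun ω => ⟪v, Y ω⟫) = gaussianReal ⟪v, μ⟫ (σ ^ 2 * ‖v‖ ^ 2).toNNReal := by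
  have hg : HasGaussianLaw (fun ω => ⟪v, Y ω⟫) Pr := hY.hasGaussianLaw.map_fun (innerSL ℝ v)
  rw [hg.map_eq_gaussianReal, ← covariance_self hg.aemeasurable, covariance_inner hY,
    real_inner_self_eq_norm_sq]
  congr 1
  have h1 : ∫ ω, ⟪v, Y ω⟫ ∂Pr = ∫ x, ⟪v, x⟫ ∂(multivariateGaussian μ
      (σ ^ 2 • (1 : Matrix (Fin n) (Fin n) ℝ))) := by
    rw [← hY.map_eq, integral_map hY.aemeasurable (by fun_prop)]
  rw [h1]
  have h2 := (innerSL ℝ v).integral_comp_id_comm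
    (μ := multivariateGaussian μ (σ ^ 2 • (1 : Matrix (Fin n) (Fin n) ℝ)))
    IsGaussian.integrable_id
  rw [integral_id_multivariateGaussian] at h2
  exact h2

lemma ae_inner_ne_zero (hσ : σ ≠ 0) (hY : HasLaw Y (multivariateGaussian μ
    (σ ^ 2 • (1 : Matrix (Fin n) (Fin n) ℝ))) Pr) {v : EuclideanSpace ℝ (Fin n)} (hv : v ≠ 0) :
    ∀ᵐ ω ∂Pr, ⟪v, Y ω⟫ ≠ 0 := by
  have hm : AEMeasurable (fun ω => ⟪v, Y ω⟫) Pr :=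
    (hY.hasGaussianLaw.map_fun (innerSL ℝ v)).aemeasurable
  have h0 : (σ ^ 2 * ‖v‖ ^ 2).toNNReal ≠ 0 := by
    rw [← mul_pow]
    exact toNNReal_sq_ne_zero (mul_ne_zero hσ (norm_ne_zero_iff.2 hv))
  have := nullSingletonClass_gaussianReal (μ := ⟪v, μ⟫) h0
  refine ae_of_ae_map (p := fun x => x ≠ 0) hm ?_
  rw [hasLaw_inner hY, ae_iff]
  simp

lemma iIndepFun_inner {ι : Type*} [Fintype ι] (hY : HasLaw Y (multivariateGaussian μ
    (σ ^ 2 • (1 : Matrix (Fin n) (Fin n) ℝ))) Pr) {d : ι → EuclideanSpace ℝ (Fin n)}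
    (hd : Pairwise fun b c => ⟪d b, d c⟫ = 0) : iIndepFun (fun c ω => ⟪d c, Y ω⟫) Pr := by
  refine HasGaussianLaw.iIndepFun_of_covariance_eq_zero ?_ fun b c hbc => ?_
  · exact hY.hasGaussianLaw.map_fun (ContinuousLinearMap.pi fun c => innerSL ℝ (d c))
  · rw [covariance_inner hY, hd hbc, mul_zero]

/-- For a jointly Gaussian pair, zero covariance suffices. A functional of the projection is the
inner product of Y with a vector orthogonal to the span, a functional of the scores with a vector of
the span. -/
lemma indepFun_starProjection_inner {ι : Type*} [Fintype ι] (hY : HasLaw Y (multivariateGaussian μ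
    (σ ^ 2 • (1 : Matrix (Fin n) (Fin n) ℝ))) Pr) (d : ι → EuclideanSpace ℝ (Fin n)) :
    IndepFun (fun ω => (Submodule.span ℝ (Set.range d))ᗮ.starProjection (Y ω))
      (fun ω c => ⟪d c, Y ω⟫) Pr := by
  classical
  refine HasGaussianLaw.indepFun_of_covariance_strongDual ?_ fun L₁ L₂ => ?_
  · exact hY.hasGaussianLaw.map_fun
      ((Submodule.span ℝ (Set.range d))ᗮ.starProjection.prod
        (ContinuousLinearMap.pi fun c => innerSL ℝ (d c)))
  · set P := (Submodule.span ℝ (Set.range d))ᗮ.starProjection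
    have h1 : (L₁ ∘ fun ω => P (Y ω)) =
        fun ω => ⟪P ((InnerProductSpace.toDual ℝ _).symm L₁), Y ω⟫ := by
      funext ω
      rw [Submodule.inner_starProjection_left_eq_right, InnerProductSpace.toDual_symm_apply]
      rfl
    have h2 : (L₂ ∘ fun ω c => ⟪d c, Y ω⟫) =
        fun ω => ⟪∑ c, L₂ (Pi.single c 1) • d c, Y ω⟫ := by
      funext ω
      have h3 : (fun c => ⟪d c, Y ω⟫) = ∑ c, ⟪d c, Y ω⟫ • (Pi.single c 1 : ι → ℝ) := by
        ext b
        simp [Finset.sum_apply, Pi.single_apply]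
      rw [Function.comp_apply, h3, map_sum, sum_inner]
      refine Finset.sum_congr rfl fun c _ => ?_
      rw [map_smul, inner_smul_left, smul_eq_mul, mul_comm]
      rfl
    rw [h1, h2, covariance_inner hY]
    have h4 : ∑ c, L₂ (Pi.single c 1) • d c ∈ Submodule.span ℝ (Set.range d) :=
      Submodule.sum_mem _ fun c _ => Submodule.smul_mem _ _ (Submodule.subset_span ⟨c, rfl⟩)
    rw [Submodule.inner_left_of_mem_orthogonal h4 (Submodule.starProjection_apply_mem _ _),
      mul_zero]

end GaussianVector

/-! ### Knots as orthogonal functionals and the selection event -/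

section Knots

variable {n p : ℕ} (X : Matrix (Fin n) (Fin p) ℝ) (i : ℕ → SVar p)

/-- The vector that represents the linear functional `lam X i k`. -/
def lamVec (k : ℕ) : EuclideanSpace ℝ (Fin n) :=
  (1 - theta X i (k - 1) (i k))⁻¹ • dirVec X i k

lemma lam_eq_inner (k : ℕ) (y : EuclideanSpace ℝ (Fin n)) : lam X i k y = ⟪lamVec X i k, y⟫ := by
  rw [lam_eq, lamVec, real_inner_smul_left, div_eq_inv_mul]

lemma lamVec_mem {k l : ℕ} (hk : 1 ≤ k) (hkl : k ≤ l) : lamVec X i k ∈ modelSpace X i l :=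
  Submodule.smul_mem _ _ (dirVec_mem X i hk hkl)

lemma inner_lamVec_of_ne {k l : ℕ} (hk : 1 ≤ k) (hl : 1 ≤ l) (h : k ≠ l) :
    ⟪lamVec X i k, lamVec X i l⟫ = 0 := by
  rw [lamVec, lamVec, real_inner_smul_left, real_inner_smul_right, inner_dirVec_of_ne X i hk hl h]
  simp

variable {X i} {K : ℕ}

lemma one_sub_theta_pos (hirr : IrrCheck X K i) (hLI : LI X i (K + 1)) {k : ℕ}
    (hk : k ∈ Set.Icc 1 (K + 1)) : 0 < 1 - theta X i (k - 1) (i k) := by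
  obtain ⟨k, rfl⟩ : ∃ k', k = k' + 1 := ⟨k - 1, by have := hk.1; omega⟩
  exact sub_pos.2 (theta_lt_one X i hirr (Nat.le_of_succ_le_succ hk.2)
    (mem_inactive_of_notMem X i (hLI.mono X i hk.2).notMem))

lemma norm_lamVec (hirr : IrrCheck X K i) (hLI : LI X i (K + 1)) {k : ℕ}
    (hk : k ∈ Set.Icc 1 (K + 1)) : ‖lamVec X i k‖ = rho X i k := by
  rw [rho_eq X i (hLI.mono X i ((Nat.sub_le _ _).trans hk.2)), lamVec, norm_smul, norm_inv,
    Real.norm_of_nonneg (one_sub_theta_pos hirr hLI hk).le, div_eq_inv_mul]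

lemma lamVec_ne_zero (hirr : IrrCheck X K i) (hLI : LI X i (K + 1)) {k : ℕ}
    (hk : k ∈ Set.Icc 1 (K + 1)) : lamVec X i k ≠ 0 :=
  smul_ne_zero (inv_ne_zero (one_sub_theta_pos hirr hLI hk).ne') (dirVec_ne_zero X i hLI hk)

lemma rho_pos (hirr : IrrCheck X K i) (hLI : LI X i (K + 1)) {k : ℕ}
    (hk : k ∈ Set.Icc 1 (K + 1)) : 0 < rho X i k := by
  rw [← norm_lamVec hirr hLI hk]
  exact norm_pos_iff.2 (lamVec_ne_zero hirr hLI hk)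

/-- Each exclusion concerns a hyperplane with nonzero normal. For two consecutive knots the normal
is a difference of orthogonal nonzero vectors. -/
lemma ae_generic {Ω : Type*} [MeasurableSpace Ω] {Pr : Measure Ω}
    {Y : Ω → EuclideanSpace ℝ (Fin n)} {μ : EuclideanSpace ℝ (Fin n)} {σ : ℝ} (hσ : σ ≠ 0)
    (hY : HasLaw Y (multivariateGaussian μ (σ ^ 2 • (1 : Matrix (Fin n) (Fin n) ℝ))) Pr)
    (hirr : IrrCheck X K i) : ∀ᵐ ω ∂Pr, Generic X i (Y ω) K := by
  refine Filter.Eventually.and ?_ ?_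
  · rw [ae_all_iff]
    intro k
    rw [ae_all_iff]
    intro _
    rw [ae_all_iff]
    intro j
    rw [ae_all_iff]
    intro hj
    exact ae_inner_ne_zero hσ hY (mt (perp_eq_zero_iff X i).1 hj)
  · rw [ae_all_iff]
    intro hLI
    rw [ae_all_iff]
    intro k
    rw [ae_all_iff]
    intro hk
    have hv : lamVec X i k - lamVec X i (k + 1) ≠ 0 := by
      intro h0
      have h1 : ⟪lamVec X i k, lamVec X i k - lamVec X i (k + 1)⟫ = 0 := by rw [h0, inner_zero_right]
      rw [inner_sub_right, inner_lamVec_of_ne X i hk.1 (Nat.le_add_left 1 k) (Nat.ne_of_lt k.lt_succ_self),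
        sub_zero] at h1
      exact lamVec_ne_zero hirr hLI ⟨hk.1, hk.2.trans K.le_succ⟩ (inner_self_eq_zero.1 h1)
    filter_upwards [ae_inner_ne_zero hσ hY hv] with ω hω
    rwa [inner_sub_left, sub_ne_zero, ← lam_eq_inner, ← lam_eq_inner] at hω

variable {tie : Finset (SVar p) → SVar p} {y : EuclideanSpace ℝ (Fin n)}

lemma knot_eq_lam (hirr : IrrCheck X K i) (hr : K < X.rank)
    (htie : ∀ t, t.Nonempty → tie t ∈ t) (hgen : Generic X i y K)
    (hi : ∀ l ∈ Set.Icc 1 (K + 1), ihat X tie y l = i l) {k : ℕ} (hk : k ∈ Set.Icc 1 (K + 1)) :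
    knot X tie y k = lam X i k y := by
  obtain ⟨k, rfl⟩ : ∃ k', k = k' + 1 := ⟨k - 1, by have := hk.1; omega⟩
  exact ((stepOutcome_of_ihat_eq hirr hr htie hgen hi (Nat.le_of_succ_le_succ hk.2)).1.ihat_mem
    htie (hi _ hk)).2

/-- The inequalities are weak, to match the closed conditions in 𝒟; genericity supplies the strict
ones that the converse needs. -/
lemma ihat_eq_iff (hirr : IrrCheck X K i) (hr : K < X.rank) (hLI : LI X i (K + 1))
    (htie : ∀ t, t.Nonempty → tie t ∈ t) (hgen : Generic X i y K) :
    (∀ l ∈ Set.Icc 1 (K + 1), ihat X tie y l = i l) ↔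
      0 < lam X i (K + 1) y ∧ (∀ k ∈ Set.Icc 1 K, lam X i (k + 1) y ≤ lam X i k y) ∧
        argmaxOn tie (inactive i K) (beta X i K y) = i (K + 1) := by
  constructor
  · intro hi
    have h := fun {k} => stepOutcome_of_ihat_eq (k := k) hirr hr htie hgen hi
    have hkn := fun {k} => knot_eq_lam (k := k) hirr hr htie hgen hi
    refine ⟨?_, fun k hk => ?_, ?_⟩
    · rw [← hkn ⟨by omega, le_rfl⟩]
      exact (h le_rfl).2.2.1
    · rw [← hkn ⟨by omega, by have := hk.2; omega⟩, ← hkn ⟨hk.1, by have := hk.2; omega⟩]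
      exact (h hk.2).2.2.2 hk.1
    · rw [← (h le_rfl).1.ihat_eq]
      exact hi _ ⟨by omega, le_rfl⟩
  · rintro ⟨hpos, hanti, harg⟩
    exact ihat_eq_of_lam_anti hirr hr hLI htie hpos
      (fun k hk => (hanti k hk).lt_of_ne (hgen.2 hLI k hk).symm) harg

variable (X i) in
/-- The statistic of the stopping rule along a fixed sequence of signed variables. -/
def selStat (K n₁ b : ℕ) (w : EuclideanSpace ℝ (Fin n)) :
    (Fin b → ℝ) × (Fin (K + 1) → SVar p) × ℝ :=
  (fun l => lam X i (l + 1) w, fun l => i (l + 1),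
    ‖(E1 X i (K + 1) n₁).starProjection w‖ / Real.sqrt n₁)

lemma measurable_lam (k : ℕ) : Measurable (lam X i k) := by
  have : lam X i k = fun y => ⟪lamVec X i k, y⟫ := funext (lam_eq_inner X i k)
  rw [this]
  fun_prop

lemma measurable_beta (k : ℕ) (j : SVar p) :
    Measurable fun y : EuclideanSpace ℝ (Fin n) => beta X i k y j := by
  unfold beta
  fun_prop

lemma measurable_selStat (n₁ b : ℕ) : Measurable (selStat X i K n₁ b) := by
  refine Measurable.prodMk (measurable_pi_lambda _ fun l => measurable_lam _)
    (measurable_const.prodMk ?_)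
  fun_prop

/-- The tie rule is arbitrary, so the event is split according to which of the finitely many finsets
is the set of maximisers. -/
lemma measurableSet_argmaxOn_eq {E : Type*} [MeasurableSpace E] (s : Set (SVar p))
    {f : E → SVar p → ℝ} (hf : ∀ j, Measurable fun w => f w j) (j : SVar p) :
    MeasurableSet {w | argmaxOn tie s (f w) = j} := by
  classical
  have h : {w | argmaxOn tie s (f w) = j} = ⋃ t ∈ {t | tie t = j},
      ⋂ l, {w | (l ∈ s ∧ ∀ l' ∈ s, f w l' ≤ f w l) ↔ l ∈ t} := by
    ext w
    simp only [argmaxOn, Set.mem_ofPred_eq, Set.mem_iUnion, Set.mem_iInter, exists_prop]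
    constructor
    · intro hw
      exact ⟨_, hw, fun l => by rw [Finset.mem_filter]; simp⟩
    · rintro ⟨t, rfl, ht⟩
      congr 1
      ext l
      rw [Finset.mem_filter, ← ht l]
      simp
  rw [h]
  refine MeasurableSet.biUnion (Set.to_countable _) fun t _ => MeasurableSet.iInter fun l => ?_
  have h2 : MeasurableSet {w | l ∈ s ∧ ∀ l' ∈ s, f w l' ≤ f w l} := by
    refine (MeasurableSet.const (l ∈ s)).inter ?_
    have : {w | ∀ l' ∈ s, f w l' ≤ f w l} = ⋂ l' ∈ s, {w | f w l' ≤ f w l} := by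
      ext w
      simp only [Set.mem_iInter, Set.mem_ofPred_eq]
    change MeasurableSet {w | ∀ l' ∈ s, f w l' ≤ f w l}
    rw [this]
    exact MeasurableSet.biInter (Set.to_countable _) fun l' _ => measurableSet_le (hf l') (hf l)
  by_cases hl : l ∈ t
  · simpa only [hl, iff_true] using h2
  · simp only [hl, iff_false]
    exact h2.compl

end Knots

/-! ### The domain of the uniform law -/

section Domain

variable {s : ℕ → ℝ} {a K : ℕ}

lemma P_Phi {i j : ℕ} (hj : s j ≠ 0) (x : ℝ) : P s i j (Phi (s j) x) = Phi (s i) x := by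
  rw [P, invFun_Phi hj]

/-- In terms of untransformed knots, the domain is the set of decreasing sequences. -/
lemma mem_domainD_iff (hs : ∀ k ∈ Set.Icc 1 (K + 1), s k ≠ 0) (ha : a + 1 ≤ K) (x : ℕ → ℝ) :
    (fun c : Fin (K - a) => Phi (s (a + 1 + c)) (x (a + 1 + c))) ∈
        domainD s a K (if a = 0 then 1 else Phi (s a) (x a)) (Phi (s (K + 1)) (x (K + 1))) ↔
      ∀ k ∈ Set.Icc 1 K, a ≤ k → x (k + 1) ≤ x k := by
  have hs1 : s (a + 1) ≠ 0 := hs _ ⟨by omega, by omega⟩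
  have hsc : ∀ c : Fin (K - a), s (a + 1 + c) ≠ 0 := fun c => hs _ ⟨by omega, by omega⟩
  have hmono : ∀ {b c : ℝ}, Phi (s (a + 1)) b ≤ Phi (s (a + 1)) c ↔ b ≤ c :=
    (Phi_strictMono hs1).le_iff_le
  -- Each 𝒫_{a+1,k} sends Φ_k(x_k) to Φ_{a+1}(x_k), so all comparisons take place on one strictly
  -- increasing scale.
  simp only [domainD, Set.mem_ofPred_eq, P_Phi (hsc _), P_Phi (hs (K + 1) ⟨by omega, le_rfl⟩),
    hmono]
  constructor
  · rintro ⟨-, h1, h2, h3⟩ k hk hak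
    rcases hak.eq_or_lt with rfl | hak
    · have := h1 ⟨0, by omega⟩ rfl
      have ha0 : a ≠ 0 := by have := hk.1; omega
      rw [if_neg ha0, if_neg ha0, P_Phi (hs a ⟨hk.1, by omega⟩)] at this
      exact hmono.1 this
    · obtain ⟨c, rfl⟩ : ∃ c, k = a + 1 + c := ⟨k - (a + 1), by omega⟩
      rcases hk.2.eq_or_lt with hkK | hkK
      · have := h3 ⟨c, by omega⟩ (by simp only; omega)
        rwa [show a + 1 + c + 1 = K + 1 by omega]
      · exact h2 ⟨c, by omega⟩ ⟨c + 1, by omega⟩ rfl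
  · intro h
    refine ⟨fun c => Phi_mem_Ioo (hsc c) _, fun c hc => ?_, fun c d hcd => ?_, fun c hc => ?_⟩
    · split_ifs with ha0
      · exact (Phi_mem_Ioo (hsc c) _).2.le
      · rw [P_Phi (hs a ⟨by omega, by omega⟩), hc]
        exact hmono.2 (h a ⟨by omega, by omega⟩ le_rfl)
    · rw [hcd]
      exact h (a + 1 + c) ⟨by omega, by omega⟩ (by omega)
    · have := h (a + 1 + c) ⟨by omega, by omega⟩ (by omega)
      rwa [show a + 1 + (c : ℕ) + 1 = K + 1 by omega] at this

lemma measurable_P {i j : ℕ} (hi : s i ≠ 0) (hj : s j ≠ 0) : Measurable (P s i j) :=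
  (Phi_continuous hi).measurable.comp (measurable_invFun_Phi hj)

/-- Joint measurability in the end values and the point is what `condKernel` requires. -/
lemma measurableSet_domainD (hs : ∀ k ∈ Set.Icc 1 (K + 1), s k ≠ 0) (ha : a + 1 ≤ K) :
    MeasurableSet {q : (ℝ × ℝ) × (Fin (K - a) → ℝ) | q.2 ∈ domainD s a K q.1.1 q.1.2} := by
  have hs1 : s (a + 1) ≠ 0 := hs _ ⟨by omega, by omega⟩
  have hsc : ∀ c : Fin (K - a), s (a + 1 + c) ≠ 0 := fun c => hs _ ⟨by omega, by omega⟩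
  have hev : ∀ c, Measurable fun q : (ℝ × ℝ) × (Fin (K - a) → ℝ) => q.2 c := fun c =>
    (measurable_pi_apply c).comp measurable_snd
  have hPev : ∀ c : Fin (K - a), Measurable fun q : (ℝ × ℝ) × (Fin (K - a) → ℝ) =>
      P s (a + 1) (a + 1 + c) (q.2 c) := fun c => (measurable_P hs1 (hsc c)).comp (hev c)
  have hforall : ∀ {ι : Type} [Countable ι] {S : ι → (ℝ × ℝ) × (Fin (K - a) → ℝ) → Prop},
      (∀ c, MeasurableSet {q | S c q}) → MeasurableSet {q | ∀ c, S c q} := fun {ι} _ {S} h => by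
    have : {q | ∀ c, S c q} = ⋂ c, {q | S c q} := by
      ext q
      simp only [Set.mem_iInter, Set.mem_ofPred_eq]
    rw [this]
    exact MeasurableSet.iInter h
  have himp : ∀ {r : Prop} {S : (ℝ × ℝ) × (Fin (K - a) → ℝ) → Prop},
      (r → MeasurableSet {q | S q}) → MeasurableSet {q | r → S q} := fun {r S} h => by
    by_cases hr : r
    · simpa [hr] using h hr
    · simp [hr]
  refine MeasurableSet.inter ?_ (MeasurableSet.inter ?_ (MeasurableSet.inter ?_ ?_))
  · exact hforall fun c => hev c measurableSet_Ioo
  · refine hforall fun c => himp fun hc => measurableSet_le (hev c) ?_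
    split_ifs with ha0
    · exact measurable_const
    · exact (measurable_P hs1 (hs a ⟨by omega, by omega⟩)).comp
        (measurable_fst.comp measurable_fst)
  · exact hforall fun c => hforall fun d => himp fun _ => measurableSet_le (hPev d) (hPev c)
  · exact hforall fun c => himp fun _ => measurableSet_le
      ((measurable_P hs1 (hs (K + 1) ⟨by omega, le_rfl⟩)).comp
        (measurable_snd.comp measurable_fst)) (hPev c)

lemma domainD_subset (u v : ℝ) :
    domainD s a K u v ⊆ Set.univ.pi fun _ => Set.Ioo (0 : ℝ) 1 := fun _ hf c _ => hf.1 c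

end Domain

lemma cond_restrict_of_subset {E : Type*} [MeasurableSpace E] (μ : Measure E) {s t : Set E}
    (h : s ⊆ t) : cond (μ.restrict t) s = cond μ s := by
  rw [ProbabilityTheory.cond, ProbabilityTheory.cond, Measure.restrict_eq_self μ h,
    Measure.restrict_restrict_of_subset h]

/-! ### Removing the directions of the free knots -/

section Selection

variable {n p : ℕ} {X : Matrix (Fin n) (Fin p) ℝ} {i : ℕ → SVar p} {K a : ℕ}

variable (X i) in
/-- The directions of the knots `λ_{a+1}, …, λ_K`. -/
def lamFamily (a K : ℕ) (c : Fin (K - a)) : EuclideanSpace ℝ (Fin n) := lamVec X i (a + 1 + c)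

variable (X i) in
/-- The projection that removes from the response the directions of `λ_{a+1}, …, λ_K`. -/
def rest (a K : ℕ) : EuclideanSpace ℝ (Fin n) →L[ℝ] EuclideanSpace ℝ (Fin n) :=
  (Submodule.span ℝ (Set.range (lamFamily X i a K)))ᗮ.starProjection

lemma sub_rest_mem (y : EuclideanSpace ℝ (Fin n)) :
    y - rest X i a K y ∈ Submodule.span ℝ (Set.range (lamFamily X i a K)) := by
  rw [rest, Submodule.starProjection_orthogonal_val, sub_sub_cancel]
  exact Submodule.starProjection_apply_mem _ _

lemma span_lamFamily_le :
    Submodule.span ℝ (Set.range (lamFamily X i a K)) ≤ modelSpace X i K := by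
  refine Submodule.span_le.2 ?_
  rintro _ ⟨c, rfl⟩
  exact lamVec_mem X i (by omega) (by omega)

lemma lam_rest {k : ℕ} (hk : 1 ≤ k) (h : k ≤ a ∨ K < k) (y : EuclideanSpace ℝ (Fin n)) :
    lam X i k (rest X i a K y) = lam X i k y := by
  have hperp : ∀ v ∈ Submodule.span ℝ (Set.range (lamFamily X i a K)), ⟪lamVec X i k, v⟫ = 0 := by
    intro v hv
    induction hv using Submodule.span_induction with
    | mem x hx =>
      obtain ⟨c, rfl⟩ := hx
      exact inner_lamVec_of_ne X i hk (by omega) (by omega)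
    | zero => simp
    | add x y _ _ hx hy => simp [inner_add_right, hx, hy]
    | smul c x _ hx => simp [inner_smul_right, hx]
  have := hperp _ (sub_rest_mem y)
  rw [inner_sub_right, sub_eq_zero] at this
  rw [lam_eq_inner, lam_eq_inner, this]

lemma beta_rest (y : EuclideanSpace ℝ (Fin n)) :
    beta X i K (rest X i a K y) = beta X i K y := by
  funext j
  have := (perp_eq_zero_iff X i).2 (span_lamFamily_le (sub_rest_mem (X := X) (i := i) (a := a)
    (K := K) y))
  rw [map_sub, sub_eq_zero] at this
  rw [beta, beta, this]

/-- The removed directions lie in H_{K+1}, to which E_1 is orthogonal, and the statistic uses only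
knots of index at most a. -/
lemma selStat_rest {n₁ b : ℕ} (hb : b ≤ a) (y : EuclideanSpace ℝ (Fin n)) :
    selStat X i K n₁ b (rest X i a K y) = selStat X i K n₁ b y := by
  have h1 : (E1 X i (K + 1) n₁).starProjection (y - rest X i a K y) = 0 := by
    rw [Submodule.starProjection_apply_eq_zero_iff]
    refine Submodule.orthogonal_le (E1_le X i (K + 1) n₁) ?_
    rw [Submodule.orthogonal_orthogonal]
    exact modelSpace_mono X i K.le_succ (span_lamFamily_le (sub_rest_mem y))
  rw [map_sub, sub_eq_zero] at h1
  refine Prod.ext (funext fun l => ?_) (Prod.ext rfl ?_)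
  · exact lam_rest (by omega) (Or.inl (by omega)) y
  · change _ / _ = _ / _
    rw [h1]

variable (X i) in
/-- The transformed knots `F_{a+1}, …, F_K` along a fixed sequence of signed variables. -/
def unifKnots (σ : ℝ) (a K : ℕ) (y : EuclideanSpace ℝ (Fin n)) (c : Fin (K - a)) : ℝ :=
  Phi (σ * rho X i (a + 1 + c)) (lam X i (a + 1 + c) y)

variable (X i) in
/-- The pair `(F_a, F_{K+1})` along a fixed sequence of signed variables. -/
def endKnots (σ : ℝ) (a K : ℕ) (y : EuclideanSpace ℝ (Fin n)) : ℝ × ℝ :=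
  (if a = 0 then 1 else Phi (σ * rho X i a) (lam X i a y),
    Phi (σ * rho X i (K + 1)) (lam X i (K + 1) y))

lemma endKnots_rest {σ : ℝ} (y : EuclideanSpace ℝ (Fin n)) :
    endKnots X i σ a K (rest X i a K y) = endKnots X i σ a K y := by
  unfold endKnots
  rw [lam_rest (by omega) (Or.inr K.lt_succ_self)]
  split_ifs with h
  · rfl
  · rw [lam_rest (by omega) (Or.inl le_rfl)]

section Law

variable {Ω : Type*} [MeasurableSpace Ω] {Pr : Measure Ω}
  {Y : Ω → EuclideanSpace ℝ (Fin n)} {μ : EuclideanSpace ℝ (Fin n)} {σ : ℝ}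

lemma mul_rho_ne_zero (hσ : σ ≠ 0) (hirr : IrrCheck X K i) (hLI : LI X i (K + 1)) :
    ∀ k ∈ Set.Icc 1 (K + 1), σ * rho X i k ≠ 0 :=
  fun _ hk => mul_ne_zero hσ (rho_pos hirr hLI hk).ne'

lemma measurable_Phi_lam {k : ℕ} (h : σ * rho X i k ≠ 0) :
    Measurable fun y => Phi (σ * rho X i k) (lam X i k y) :=
  (Phi_continuous h).measurable.comp (measurable_lam k)

lemma measurable_unifKnots (hσ : σ ≠ 0) (hirr : IrrCheck X K i) (hLI : LI X i (K + 1)) :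
    Measurable (unifKnots X i σ a K) :=
  measurable_pi_lambda _ fun c =>
    measurable_Phi_lam (mul_rho_ne_zero hσ hirr hLI _ ⟨by omega, by omega⟩)

lemma measurable_endKnots (hσ : σ ≠ 0) (hirr : IrrCheck X K i) (hLI : LI X i (K + 1))
    (haK : a ≤ K) : Measurable (endKnots X i σ a K) := by
  refine Measurable.prodMk ?_
    (measurable_Phi_lam (mul_rho_ne_zero hσ hirr hLI _ ⟨by omega, le_rfl⟩))
  split_ifs with h
  · exact measurable_const
  · exact measurable_Phi_lam (mul_rho_ne_zero hσ hirr hLI _ ⟨by omega, by omega⟩)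

/-- The null hypothesis enters here: the directions of λ_{a+1}, …, λ_K are orthogonal to H_a, which
contains the mean, so these knots are centred. -/
lemma map_unifKnots (hσ : σ ≠ 0)
    (hY : HasLaw Y (multivariateGaussian μ (σ ^ 2 • (1 : Matrix (Fin n) (Fin n) ℝ))) Pr)
    (hμ : μ ∈ modelSpace X i a) (hirr : IrrCheck X K i) (hLI : LI X i (K + 1)) :
    Pr.map (fun ω => unifKnots X i σ a K (Y ω)) =
      volume.restrict (Set.univ.pi fun _ => Set.Ioo (0 : ℝ) 1) := by
  have hne : ∀ c : Fin (K - a), σ * rho X i (a + 1 + c) ≠ 0 := fun c =>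
    mul_rho_ne_zero hσ hirr hLI _ ⟨by omega, by omega⟩
  have hPhi : ∀ c : Fin (K - a), Measurable (Phi (σ * rho X i (a + 1 + c))) := fun c =>
    (Phi_continuous (hne c)).measurable
  have hm : ∀ c : Fin (K - a), AEMeasurable (fun ω => ⟪lamFamily X i a K c, Y ω⟫) Pr := fun c =>
    (hY.hasGaussianLaw.map_fun (innerSL ℝ (lamFamily X i a K c))).aemeasurable
  have hind : iIndepFun (fun c ω => ⟪lamFamily X i a K c, Y ω⟫) Pr :=
    iIndepFun_inner hY fun b c hbc => inner_lamVec_of_ne X i (by omega) (by omega)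
      fun h => hbc (Fin.ext (by omega))
  have hcomp := hind.comp (fun c => Phi (σ * rho X i (a + 1 + c))) hPhi
  have hlaw : ∀ c : Fin (K - a), Pr.map (Phi (σ * rho X i (a + 1 + c)) ∘
      fun ω => ⟪lamFamily X i a K c, Y ω⟫) = volume.restrict (Set.Ioo (0 : ℝ) 1) := by
    intro c
    have h0 : ⟪lamFamily X i a K c, μ⟫ = 0 := by
      rw [real_inner_comm, lamFamily, lamVec, real_inner_smul_right,
        inner_dirVec_of_mem X i (by omega) hμ, mul_zero]
    rw [← AEMeasurable.map_map_of_aemeasurable (hPhi c).aemeasurable (hm c), hasLaw_inner hY, h0,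
      lamFamily, norm_lamVec hirr hLI ⟨by omega, by omega⟩, ← mul_pow,
      map_Phi_gaussianReal (hne c)]
  have hpi := hcomp.map_fun_eq_pi_map fun c => (hPhi c).comp_aemeasurable (hm c)
  simp only [hlaw] at hpi
  rw [volume_pi, Measure.restrict_pi_pi, ← hpi]
  congr 1
  funext ω c
  rw [unifKnots, lam_eq_inner]
  rfl

/-- The uniform law, given an event described by the knots along `i`. -/
theorem condDistrib_unifKnots [IsProbabilityMeasure Pr] (hσ : σ ≠ 0) (hYm : Measurable Y)
    (hY : HasLaw Y (multivariateGaussian μ (σ ^ 2 • (1 : Matrix (Fin n) (Fin n) ℝ))) Pr)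
    (hμ : μ ∈ modelSpace X i a) (hirr : IrrCheck X K i) (hLI : LI X i (K + 1)) (ha : a + 1 ≤ K)
    {G : Set (EuclideanSpace ℝ (Fin n))} (hG : MeasurableSet G)
    {A : Set Ω} (hA : A = {ω | rest X i a K (Y ω) ∈ G ∧ unifKnots X i σ a K (Y ω) ∈
      domainD (fun k => σ * rho X i k) a K (endKnots X i σ a K (Y ω)).1
        (endKnots X i σ a K (Y ω)).2}) :
    ∀ᵐ ω ∂(cond Pr A), condDistrib (fun ω => unifKnots X i σ a K (Y ω))
        (fun ω => endKnots X i σ a K (Y ω)) (cond Pr A) (endKnots X i σ a K (Y ω)) =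
      cond volume (domainD (fun k => σ * rho X i k) a K (endKnots X i σ a K (Y ω)).1
        (endKnots X i σ a K (Y ω)).2) := by
  have hs := mul_rho_ne_zero hσ hirr hLI
  have hPhi : ∀ c : Fin (K - a), Measurable (Phi (σ * rho X i (a + 1 + c))) := fun c =>
    (Phi_continuous (hs _ ⟨by omega, by omega⟩)).measurable
  have hind : IndepFun (fun ω => rest X i a K (Y ω)) (fun ω => unifKnots X i σ a K (Y ω)) Pr := by
    have hψ : Measurable fun (x : Fin (K - a) → ℝ) (c : Fin (K - a)) =>
        Phi (σ * rho X i (a + 1 + c)) (x c) :=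
      measurable_pi_lambda _ fun c => (hPhi c).comp (measurable_pi_apply c)
    have h := (indepFun_starProjection_inner hY (lamFamily X i a K)).comp measurable_id hψ
    convert h using 1
    · rfl
    · funext ω c
      rw [unifKnots, lam_eq_inner]
      rfl
  have hmain := condDistrib_cond_of_indepFun (u := fun ω => rest X i a K (Y ω))
    (L := fun ω => unifKnots X i σ a K (Y ω)) (by fun_prop) ((measurable_unifKnots hσ hirr hLI).comp hYm) hind
    (measurable_endKnots hσ hirr hLI (by omega : a ≤ K)) hG
    (D := fun q => domainD (fun k => σ * rho X i k) a K q.1 q.2) (measurableSet_domainD hs ha)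
  -- The end knots of `rest` are those of Y, and restricting Lebesgue measure to the cube changes
  -- nothing on 𝒟, a subset of the cube.
  simp only [endKnots_rest, map_unifKnots hσ hY hμ hirr hLI,
    cond_restrict_of_subset _ (domainD_subset _ _)] at hmain
  subst hA
  exact hmain

end Law

end Selection

/-! ### The selection event in terms of the knots along i -/

section Event

variable {n p : ℕ} {X : Matrix (Fin n) (Fin p) ℝ} {tie : Finset (SVar p) → SVar p}
  {i : ℕ → SVar p} {K a n₁ : ℕ}

variable (X tie i) in
/-- The part of the selection event that does not involve the knots `λ_{a+1}, …, λ_K`; the sets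
`B` and `B'` describe `{m̂ ≤ a}` and `{m̂ ≤ a - 1}`. -/
def selSet (K n₁ a : ℕ) (B : Set ((Fin a → ℝ) × (Fin (K + 1) → SVar p) × ℝ))
    (B' : Set ((Fin (a - 1) → ℝ) × (Fin (K + 1) → SVar p) × ℝ)) :
    Set (EuclideanSpace ℝ (Fin n)) :=
  {w | 0 < lam X i (K + 1) w ∧ (∀ k ∈ Set.Ico 1 a, lam X i (k + 1) w ≤ lam X i k w) ∧
    argmaxOn tie (inactive i K) (beta X i K w) = i (K + 1) ∧ selStat X i K n₁ a w ∈ B ∧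
    (0 < a → selStat X i K n₁ (a - 1) w ∉ B')}

lemma measurableSet_selSet {B : Set ((Fin a → ℝ) × (Fin (K + 1) → SVar p) × ℝ)}
    {B' : Set ((Fin (a - 1) → ℝ) × (Fin (K + 1) → SVar p) × ℝ)} (hB : MeasurableSet B)
    (hB' : MeasurableSet B') : MeasurableSet (selSet X tie i K n₁ a B B') := by
  refine (measurableSet_lt measurable_const (measurable_lam _)).inter (MeasurableSet.inter ?_
    ((measurableSet_argmaxOn_eq _ (measurable_beta K) _).inter
      ((measurable_selStat n₁ a hB).inter ?_)))
  · have : {w : EuclideanSpace ℝ (Fin n) | ∀ k ∈ Set.Ico 1 a, lam X i (k + 1) w ≤ lam X i k w} =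
        ⋂ k ∈ Set.Ico 1 a, {w | lam X i (k + 1) w ≤ lam X i k w} := by
      ext w
      simp only [Set.mem_iInter, Set.mem_ofPred_eq]
    change MeasurableSet {w : EuclideanSpace ℝ (Fin n) |
      ∀ k ∈ Set.Ico 1 a, lam X i (k + 1) w ≤ lam X i k w}
    rw [this]
    exact MeasurableSet.biInter (Set.to_countable _) fun k _ =>
      measurableSet_le (measurable_lam _) (measurable_lam _)
  · by_cases h : 0 < a
    · have : {w : EuclideanSpace ℝ (Fin n) | 0 < a → selStat X i K n₁ (a - 1) w ∉ B'} =
          (selStat X i K n₁ (a - 1) ⁻¹' B')ᶜ := by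
        ext w
        simp [h]
      change MeasurableSet {w : EuclideanSpace ℝ (Fin n) |
        0 < a → selStat X i K n₁ (a - 1) w ∉ B'}
      rw [this]
      exact (measurable_selStat n₁ (a - 1) hB').compl
    · have : {w : EuclideanSpace ℝ (Fin n) | 0 < a → selStat X i K n₁ (a - 1) w ∉ B'} =
          Set.univ := by
        ext w
        simp [h]
      change MeasurableSet {w : EuclideanSpace ℝ (Fin n) |
        0 < a → selStat X i K n₁ (a - 1) w ∉ B'}
      rw [this]
      exact MeasurableSet.univ

lemma selStat_eq {y : EuclideanSpace ℝ (Fin n)} (hirr : IrrCheck X K i) (hr : K < X.rank)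
    (htie : ∀ t, t.Nonempty → tie t ∈ t) (hgen : Generic X i y K)
    (hi : ∀ l ∈ Set.Icc 1 (K + 1), ihat X tie y l = i l) {b : ℕ} (hb : b ≤ K) :
    ((fun l : Fin b => knot X tie y (l + 1)), (fun l : Fin (K + 1) => ihat X tie y (l + 1)),
      sigmaSelect X tie K n₁ y) = selStat X i K n₁ b y := by
  refine Prod.ext (funext fun l => ?_) (Prod.ext (funext fun l => ?_) ?_)
  · exact knot_eq_lam hirr hr htie hgen hi ⟨by omega, by omega⟩
  · exact hi _ ⟨by omega, by omega⟩
  · change sigmaSelect X tie K n₁ y = _ / _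
    simp only [sigmaSelect, E1_congr X hi]

/-- On a generic response the selection event is described by the knots along `i`. -/
lemma selection_iff {y : EuclideanSpace ℝ (Fin n)} {σ : ℝ} (hσ : σ ≠ 0) (hirr : IrrCheck X K i)
    (hr : K < X.rank) (hLI : LI X i (K + 1)) (htie : ∀ t, t.Nonempty → tie t ∈ t)
    (hgen : Generic X i y K) (ha : a + 1 ≤ K) {m : ℕ}
    {B : Set ((Fin a → ℝ) × (Fin (K + 1) → SVar p) × ℝ)}
    {B' : Set ((Fin (a - 1) → ℝ) × (Fin (K + 1) → SVar p) × ℝ)}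
    (hB : m ≤ a ↔ ((fun l : Fin a => knot X tie y (l + 1)),
      (fun l : Fin (K + 1) => ihat X tie y (l + 1)), sigmaSelect X tie K n₁ y) ∈ B)
    (hB' : m ≤ a - 1 ↔ ((fun l : Fin (a - 1) => knot X tie y (l + 1)),
      (fun l : Fin (K + 1) => ihat X tie y (l + 1)), sigmaSelect X tie K n₁ y) ∈ B') :
    (m = a ∧ ∀ l ∈ Set.Icc 1 (K + 1), ihat X tie y l = i l) ↔
      rest X i a K y ∈ selSet X tie i K n₁ a B B' ∧ unifKnots X i σ a K y ∈
        domainD (fun k => σ * rho X i k) a K (endKnots X i σ a K y).1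
          (endKnots X i σ a K y).2 := by
  have hdom := mem_domainD_iff (mul_rho_ne_zero hσ hirr hLI) ha fun k => lam X i k y
  have hG : rest X i a K y ∈ selSet X tie i K n₁ a B B' ↔
      0 < lam X i (K + 1) y ∧ (∀ k ∈ Set.Ico 1 a, lam X i (k + 1) y ≤ lam X i k y) ∧
        argmaxOn tie (inactive i K) (beta X i K y) = i (K + 1) ∧ selStat X i K n₁ a y ∈ B ∧
        (0 < a → selStat X i K n₁ (a - 1) y ∉ B') := by
    rw [selSet, Set.mem_ofPred_eq, lam_rest (by omega) (Or.inr K.lt_succ_self), beta_rest,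
      selStat_rest le_rfl, selStat_rest (Nat.sub_le a 1)]
    refine and_congr_right fun _ => and_congr_left fun _ => forall₂_congr fun k hk => ?_
    rw [lam_rest (by omega) (Or.inl (by have := hk.2; omega)),
      lam_rest hk.1 (Or.inl hk.2.le)]
  -- The guard 0 < a matters: for a = 0 the truncated a - 1 is again 0, and there is no smaller
  -- model to exclude.
  have hm : m = a ↔ m ≤ a ∧ (0 < a → ¬ m ≤ a - 1) := by omega
  have hiff := ihat_eq_iff hirr hr hLI htie hgen
  have hstat := fun hi {b} hb => selStat_eq (n₁ := n₁) (b := b) hirr hr htie hgen hi hb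
  rw [hG]
  refine Iff.trans ?_ (and_congr_right fun _ => hdom.symm)
  constructor
  · rintro ⟨rfl, hi⟩
    obtain ⟨h1, h2, h3⟩ := hiff.1 hi
    refine ⟨⟨h1, fun k hk => h2 k ⟨hk.1, by have := hk.2; omega⟩, h3, ?_, fun h0 => ?_⟩,
      fun k hk _ => h2 k hk⟩
    · rw [← hstat hi (by omega)]
      exact hB.1 le_rfl
    · rw [← hstat hi (by omega), ← hB']
      exact (hm.1 rfl).2 h0
  · rintro ⟨⟨h1, h2, h3, h4, h5⟩, h6⟩
    -- The order of the knots is assembled from two parts: indices below a come from `selSet`,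
    -- indices from a on come from the domain.
    have hi := hiff.2 ⟨h1, fun k hk => (lt_or_ge k a).elim (fun h => h2 k ⟨hk.1, h⟩) (h6 k hk), h3⟩
    refine ⟨hm.2 ⟨?_, fun h0 => ?_⟩, hi⟩
    · rw [hB, hstat hi (by omega)]
      exact h4
    · rw [hB', hstat hi (by omega)]
      exact h5 h0

lemma F_eq {y : EuclideanSpace ℝ (Fin n)} {σ : ℝ} (hirr : IrrCheck X K i) (hr : K < X.rank)
    (htie : ∀ t, t.Nonempty → tie t ∈ t) (hgen : Generic X i y K)
    (hi : ∀ l ∈ Set.Icc 1 (K + 1), ihat X tie y l = i l) {k : ℕ} (hk : k ≤ K + 1) :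
    F X tie σ y k = if k = 0 then 1 else Phi (σ * rho X i k) (lam X i k y) := by
  unfold F
  split_ifs with h
  · rfl
  · rw [knot_eq_lam hirr hr htie hgen hi ⟨by omega, hk⟩,
      rho_congr X (by omega) fun l hl => hi l ⟨hl.1, hl.2.trans hk⟩]

end Event

end

end LAR

/-! ### The conditional law of the transformed knots -/

theorem mainTheorem8 {n p K a n₁ n₂ : ℕ}
    -- the linear model `Y ~ N(Xβ⁰, σ² Id)`
    (X : Matrix (Fin n) (Fin p) ℝ) (β : Fin p → ℝ) (σ : ℝ) (hσ : 0 < σ)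
    {Ω : Type*} [MeasurableSpace Ω] (Pr : Measure Ω) [IsProbabilityMeasure Pr]
    (Y : Ω → EuclideanSpace ℝ (Fin n)) (hYm : Measurable Y)
    (hY : HasLaw Y (multivariateGaussian (WithLp.toLp 2 (X.mulVec β))
      (σ ^ 2 • (1 : Matrix (Fin n) (Fin n) ℝ))) Pr)
    -- the rule by which the algorithm breaks ties between maximisers
    (tie : Finset (LAR.SVar p) → LAR.SVar p) (htie : ∀ s, s.Nonempty → tie s ∈ s)
    -- `1 ≤ K < min(n - 3, rank X)`, `n = n₁ + n₂ + (K + 1)`, `0 ≤ a ≤ K - 1`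
    (hK : 1 ≤ K) (hKn : K + 3 < n) (hKr : K < X.rank)
    (hn₁ : 1 ≤ n₁) (hn₂ : 1 ≤ n₂) (hn : n = n₁ + n₂ + (K + 1)) (ha : a + 1 ≤ K)
    (mhat : Ω → ℕ) (hm : LAR.IsStoppingRule X tie K n₁ Y mhat)
    -- the values of the selected signed variables, with the null hypothesis `Xβ⁰ ∈ H_a`
    (i : ℕ → LAR.SVar p) (hirr : LAR.IrrCheck X K i)
    (hH0 : WithLp.toLp 2 (X.mulVec β) ∈ LAR.modelSpace X i a)
    -- the selection event, and the conditional probability given it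
    (A : Set Ω)
    (hA : A = {ω | mhat ω = a ∧ ∀ k ∈ Set.Icc 1 (K + 1), LAR.ihat X tie (Y ω) k = i k})
    (hA0 : Pr A ≠ 0) :
    ∀ᵐ ω ∂(ProbabilityTheory.cond Pr A),
      condDistrib
        (fun ω' => fun c : Fin (K - a) => LAR.F X tie σ (Y ω') (a + 1 + c))
        (fun ω' => (LAR.F X tie σ (Y ω') a, LAR.F X tie σ (Y ω') (K + 1)))
        (ProbabilityTheory.cond Pr A)
        (LAR.F X tie σ (Y ω) a, LAR.F X tie σ (Y ω) (K + 1)) =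
      ProbabilityTheory.cond volume
        (LAR.domainD (fun k => σ * LAR.rho X i k) a K
          (LAR.F X tie σ (Y ω) a) (LAR.F X tie σ (Y ω) (K + 1))) := by
  subst hA
  set A := {ω | mhat ω = a ∧ ∀ k ∈ Set.Icc 1 (K + 1), LAR.ihat X tie (Y ω) k = i k} with hA
  set s : ℕ → ℝ := fun k => σ * LAR.rho X i k with hs
  have hgen : ∀ᵐ ω ∂Pr, LAR.Generic X i (Y ω) K := LAR.ae_generic hσ.ne' hY hirr
  -- One generic outcome in the event of positive probability is enough for linear independence, a
  -- deterministic property of X and i.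
  obtain ⟨ω₀, hω₀, hgen₀⟩ : ∃ ω ∈ A, LAR.Generic X i (Y ω) K := by
    by_contra! h
    exact hA0 (measure_mono_null h hgen)
  have hLI : LAR.LI X i (K + 1) := (LAR.stepOutcome_of_ihat_eq hirr hKr htie hgen₀ hω₀.2 le_rfl).2.1
  obtain ⟨B, hBm, hB⟩ := hm.2 a (by omega)
  obtain ⟨B', hBm', hB'⟩ := hm.2 (a - 1) (by omega)
  set A' := {ω | LAR.rest X i a K (Y ω) ∈ LAR.selSet X tie i K n₁ a B B' ∧
    LAR.unifKnots X i σ a K (Y ω) ∈ LAR.domainD s a K (LAR.endKnots X i σ a K (Y ω)).1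
      (LAR.endKnots X i σ a K (Y ω)).2} with hA'
  have hAA' : A =ᵐ[Pr] A' := by
    filter_upwards [hgen] with ω hω
    exact propext (LAR.selection_iff hσ.ne' hirr hKr hLI htie hω ha (hB ω) (hB' ω))
  have hcond : cond Pr A = cond Pr A' := by
    rw [ProbabilityTheory.cond, ProbabilityTheory.cond, measure_congr hAA',
      Measure.restrict_congr_set hAA']
  have hmain := LAR.condDistrib_unifKnots hσ.ne' hYm hY hH0 hirr hLI ha
    (LAR.measurableSet_selSet (X := X) (tie := tie) (i := i) (n₁ := n₁) hBm hBm') hA'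
  have hAmem : ∀ᵐ ω ∂(cond Pr A), ω ∈ A ∧ LAR.Generic X i (Y ω) K := by
    -- The event A is not assumed measurable; its null measurability comes from its almost sure
    -- equality with the measurable set A'.
    have hA'm : NullMeasurableSet A' Pr := by
      refine MeasurableSet.nullMeasurableSet (MeasurableSet.inter ?_ ?_)
      · exact ((LAR.rest X i a K).continuous.measurable.comp hYm)
          (LAR.measurableSet_selSet hBm hBm')
      · exact ((((LAR.measurable_endKnots hσ.ne' hirr hLI (by omega : a ≤ K)).comp hYm).prodMk
          ((LAR.measurable_unifKnots hσ.ne' hirr hLI).comp hYm)))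
            (LAR.measurableSet_domainD (LAR.mul_rho_ne_zero hσ.ne' hirr hLI) ha)
    exact (ae_cond_mem₀ (hA'm.congr hAA'.symm)).and (cond_absolutelyContinuous.ae_le hgen)
  have hf : (fun ω' => fun c : Fin (K - a) => LAR.F X tie σ (Y ω') (a + 1 + c)) =ᵐ[cond Pr A]
      fun ω => LAR.unifKnots X i σ a K (Y ω) := by
    filter_upwards [hAmem] with ω hω
    funext c
    rw [LAR.F_eq hirr hKr htie hω.2 hω.1.2 (by omega), if_neg (by omega), LAR.unifKnots]
  have hg : (fun ω' => (LAR.F X tie σ (Y ω') a, LAR.F X tie σ (Y ω') (K + 1))) =ᵐ[cond Pr A]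
      fun ω => LAR.endKnots X i σ a K (Y ω) := by
    filter_upwards [hAmem] with ω hω
    rw [LAR.F_eq hirr hKr htie hω.2 hω.1.2 (by omega), LAR.F_eq hirr hKr htie hω.2 hω.1.2 le_rfl,
      if_neg (Nat.succ_ne_zero K), LAR.endKnots]
  -- Generalising the measure to ν allows `cond Pr A` to be replaced by `cond Pr A'` inside
  -- `condDistrib` as well, where the measure carries a finiteness instance.
  have transfer : ∀ (ν : Measure Ω) [IsFiniteMeasure ν], ν = cond Pr A' →
      (fun ω' => fun c : Fin (K - a) => LAR.F X tie σ (Y ω') (a + 1 + c)) =ᵐ[ν]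
        (fun ω => LAR.unifKnots X i σ a K (Y ω)) →
      (fun ω' => (LAR.F X tie σ (Y ω') a, LAR.F X tie σ (Y ω') (K + 1))) =ᵐ[ν]
        (fun ω => LAR.endKnots X i σ a K (Y ω)) →
      ∀ᵐ ω ∂ν, condDistrib
          (fun ω' => fun c : Fin (K - a) => LAR.F X tie σ (Y ω') (a + 1 + c))
          (fun ω' => (LAR.F X tie σ (Y ω') a, LAR.F X tie σ (Y ω') (K + 1))) ν
          (LAR.F X tie σ (Y ω) a, LAR.F X tie σ (Y ω) (K + 1)) =
        cond volume (LAR.domainD s a K (LAR.F X tie σ (Y ω) a) (LAR.F X tie σ (Y ω) (K + 1))) := by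
    rintro ν _ rfl hf hg
    rw [condDistrib_congr hf hg]
    filter_upwards [hmain, hg] with ω h1 h2
    rw [← h2] at h1
    exact h1
  exact transfer _ hcond hf hg
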